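/- Let $p$ be a prime, let $h \geq 1$ and $n \geq p^{h+1}$ be integers, and let $H$ be a (one-dimensional, commutative) formal group law over $\mathbb{F}_p$ with $[p]_H(T) = T^{p^h}$, where $[1]_H(T) = T$ and $[m+1]_H(T) = H([m]_H(T), T)$. Let $H^{(n)} \in \mathbb{F}_p[T_1,T_2]/(T_1,T_2)^{n+1}$ be the $n$-bud law obtained from $H$ by discarding the terms of degree $\geq n+1$. For an $\mathbb{F}_p$-scheme $S$, let $\operatorname{Aut}_{\Gamma(S)}(H^{(n)})$ be the group, under composition, of automorphisms of $H^{(n)}$ regarded as a bud law over $\Gamma(S) = \Gamma(S,\mathcal{O}_S)$, that is, the group of invertible elements of the monoid of all $f(T) \in \Gamma(S)[T]/(T)^{n+1}$ with constant term $0$ such that $f(H^{(n)}(T_1,T_2)) = H^{(n)}(f(T_1), f(T_2))$ in $\Gamma(S)[T_1,T_2]/(T_1,T_2)^{n+1}$. Then the presheaf of groups $\mathcal{A}ut(H^{(n)}) \colon S \mapsto \operatorname{Aut}_{\Gamma(S)}(H^{(n)})$ on the category of $\mathbb{F}_p$-schemes is represented by a group scheme over $\operatorname{Spec} \mathbb{F}_p$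 that is smooth of dimension $h$ over $\operatorname{Spec} \mathbb{F}_p$ (smooth of relative dimension $h$, and its underlying space has Krull dimension $h$). -/

import Mathlib

open CategoryTheory AlgebraicGeometry Opposite

noncomputable section

namespace FormalBud

/-- The truncated polynomial ring `A[T_i : i ∈ σ] / (T_i : i ∈ σ)^(n+1)`. -/
abbrev TruncPoly (σ : Type) (A : Type) [CommRing A] (n : ℕ) : Type :=
  MvPolynomial σ A ⧸ (MvPolynomial.idealOfVars σ A) ^ (n + 1)

/-- The ideal of truncated polynomials with constant term `0`. -/
def augIdeal (σ : Type) (A : Type) [CommRing A] (n : ℕ) : Ideal (TruncPoly σ A n) :=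
  (MvPolynomial.idealOfVars σ A).map
    (Ideal.Quotient.mk ((MvPolynomial.idealOfVars σ A) ^ (n + 1)))

/-- Truncated polynomials with constant term `0`; these are the ones that can be
substituted into truncated polynomials. -/
abbrev Aug (σ : Type) (A : Type) [CommRing A] (n : ℕ) : Type := ↥(augIdeal σ A n)

section Subst

variable {σ τ υ : Type} {A : Type} [CommRing A] {n : ℕ}

lemma augIdeal_pow_eq_bot : augIdeal σ A n ^ (n + 1) = ⊥ := by
  rw [augIdeal, ← Ideal.map_pow, Ideal.map_quotient_self]

/-- The class of the variable `T_i`. -/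
def var (i : σ) : Aug σ A n :=
  ⟨Ideal.Quotient.mk _ (MvPolynomial.X i),
    Ideal.mem_map_of_mem _ (Ideal.subset_span ⟨i, rfl⟩)⟩

lemma aeval_mem_augIdeal (g : σ → Aug τ A n) {q : MvPolynomial σ A}
    (hq : q ∈ MvPolynomial.idealOfVars σ A) :
    MvPolynomial.aeval (fun i => (g i : TruncPoly τ A n)) q ∈ augIdeal τ A n := by
  have h : MvPolynomial.idealOfVars σ A ≤ (augIdeal τ A n).comap
      (MvPolynomial.aeval (R := A) (fun i => (g i : TruncPoly τ A n))) := by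
    refine Ideal.span_le.2 ?_
    rintro _ ⟨i, rfl⟩
    simp
  exact h hq

/-- The `A`-algebra homomorphism `T_i ↦ g_i` between truncated polynomial rings. -/
def substAlgHom (g : σ → Aug τ A n) : TruncPoly σ A n →ₐ[A] TruncPoly τ A n :=
  Ideal.Quotient.liftₐ _ (MvPolynomial.aeval (fun i => (g i : TruncPoly τ A n))) (by
    intro q hq
    have h : (MvPolynomial.idealOfVars σ A) ^ (n + 1) ≤ (⊥ : Ideal (TruncPoly τ A n)).comap
        (MvPolynomial.aeval (R := A) (fun i => (g i : TruncPoly τ A n))) := by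
      rw [← augIdeal_pow_eq_bot (σ := τ)]
      refine le_trans (Ideal.pow_right_mono ?_ _) (Ideal.le_comap_pow _ _)
      intro x hx
      exact aeval_mem_augIdeal g hx
    simpa using h hq)

@[simp] lemma substAlgHom_mk (g : σ → Aug τ A n) (q : MvPolynomial σ A) :
    substAlgHom g (Ideal.Quotient.mk _ q) =
      MvPolynomial.aeval (fun i => (g i : TruncPoly τ A n)) q := rfl

lemma substAlgHom_mem (g : σ → Aug τ A n) {f : TruncPoly σ A n} (hf : f ∈ augIdeal σ A n) :
    substAlgHom g f ∈ augIdeal τ A n := by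
  obtain ⟨q, hq, rfl⟩ := (Ideal.mem_map_iff_of_surjective _ Ideal.Quotient.mk_surjective).1 hf
  exact aeval_mem_augIdeal g hq

/-- Substitution: `subst g f = f(g_i : i ∈ σ)`. -/
def subst (g : σ → Aug τ A n) (f : Aug σ A n) : Aug τ A n :=
  ⟨substAlgHom g f, substAlgHom_mem g f.2⟩

@[simp] lemma coe_subst (g : σ → Aug τ A n) (f : Aug σ A n) :
    (subst g f : TruncPoly τ A n) = substAlgHom g f := rfl

@[simp] lemma subst_var (g : σ → Aug τ A n) (i : σ) : subst g (var i) = g i := by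
  apply Subtype.ext
  simp [var]

@[simp] lemma subst_self (f : Aug σ A n) : subst var f = f := by
  obtain ⟨f, hf⟩ := f
  obtain ⟨q, rfl⟩ := Ideal.Quotient.mk_surjective f
  apply Subtype.ext
  simp only [coe_subst, substAlgHom_mk, var]
  rw [← MvPolynomial.mkₐ_eq_aeval]
  rfl

lemma subst_subst (h : τ → Aug υ A n) (g : σ → Aug τ A n) (f : Aug σ A n) :
    subst h (subst g f) = subst (fun i => subst h (g i)) f := by
  obtain ⟨f, hf⟩ := f
  obtain ⟨q, rfl⟩ := Ideal.Quotient.mk_surjective f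
  apply Subtype.ext
  simp only [coe_subst, substAlgHom_mk]
  rw [← AlgHom.comp_apply, MvPolynomial.comp_aeval]

end Subst

section BaseChange

variable {σ τ : Type} {A B C : Type} [CommRing A] [CommRing B] [CommRing C] {n : ℕ}

lemma map_idealOfVars_le (φ : A →+* B) : MvPolynomial.idealOfVars σ A ≤
    (MvPolynomial.idealOfVars σ B).comap (MvPolynomial.map φ) := by
  refine Ideal.span_le.2 ?_
  rintro _ ⟨i, rfl⟩
  have h : (MvPolynomial.X i : MvPolynomial σ B) ∈ MvPolynomial.idealOfVars σ B :=
    Ideal.subset_span ⟨i, rfl⟩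
  simpa using h

/-- Application of `φ : A → B` to the coefficients of a truncated polynomial. -/
def mapRingHom (φ : A →+* B) : TruncPoly σ A n →+* TruncPoly σ B n :=
  Ideal.quotientMap _ (MvPolynomial.map φ)
    (le_trans (Ideal.pow_right_mono (map_idealOfVars_le φ) _) (Ideal.le_comap_pow _ _))

@[simp] lemma mapRingHom_mk (φ : A →+* B) (q : MvPolynomial σ A) :
    mapRingHom (n := n) φ (Ideal.Quotient.mk _ q) =
      Ideal.Quotient.mk _ (MvPolynomial.map φ q) := rfl

lemma mapRingHom_mem (φ : A →+* B) {f : TruncPoly σ A n} (hf : f ∈ augIdeal σ A n) :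
    mapRingHom φ f ∈ augIdeal σ B n := by
  obtain ⟨q, hq, rfl⟩ := (Ideal.mem_map_iff_of_surjective _ Ideal.Quotient.mk_surjective).1 hf
  exact Ideal.mem_map_of_mem _ (map_idealOfVars_le φ hq)

/-- Application of `φ : A → B` to the coefficients, on truncated polynomials with constant
term `0`. -/
def mapAug (φ : A →+* B) (f : Aug σ A n) : Aug σ B n := ⟨mapRingHom φ f, mapRingHom_mem φ f.2⟩

@[simp] lemma mapAug_var (φ : A →+* B) (i : σ) :
    mapAug φ (var i : Aug σ A n) = var i := by
  apply Subtype.ext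
  simp [mapAug, var]

@[simp] lemma mapAug_zero (φ : A →+* B) : mapAug φ (0 : Aug σ A n) = 0 := by
  apply Subtype.ext
  simp [mapAug]

lemma mapAug_id (f : Aug σ A n) : mapAug (RingHom.id A) f = f := by
  obtain ⟨f, hf⟩ := f
  obtain ⟨q, rfl⟩ := Ideal.Quotient.mk_surjective f
  apply Subtype.ext
  simp only [mapAug, mapRingHom_mk, MvPolynomial.map_id]

lemma mapAug_mapAug (ψ : B →+* C) (φ : A →+* B) (f : Aug σ A n) :
    mapAug ψ (mapAug φ f) = mapAug (ψ.comp φ) f := by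
  obtain ⟨f, hf⟩ := f
  obtain ⟨q, rfl⟩ := Ideal.Quotient.mk_surjective f
  apply Subtype.ext
  simp [mapAug, MvPolynomial.map_map]

lemma mapAug_subst (φ : A →+* B) (g : σ → Aug τ A n) (f : Aug σ A n) :
    mapAug φ (subst g f) = subst (fun i => mapAug φ (g i)) (mapAug φ f) := by
  obtain ⟨f, hf⟩ := f
  obtain ⟨q, rfl⟩ := Ideal.Quotient.mk_surjective f
  apply Subtype.ext
  have key : (mapRingHom φ).comp (MvPolynomial.aeval (R := A)
        (fun i => (g i : TruncPoly τ A n)) : MvPolynomial σ A →+* TruncPoly τ A n) =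
      (MvPolynomial.aeval (R := B) (fun i => mapRingHom φ (g i : TruncPoly τ A n)) :
        MvPolynomial σ B →+* TruncPoly τ B n).comp (MvPolynomial.map φ) := by
    apply MvPolynomial.ringHom_ext
    · intro a
      simp only [RingHom.comp_apply, RingHom.coe_coe, MvPolynomial.algHom_C, MvPolynomial.map_C]
      change mapRingHom φ (Ideal.Quotient.mk _ (MvPolynomial.C a)) =
        Ideal.Quotient.mk _ (MvPolynomial.C (φ a))
      simp
    · intro i
      simp
  exact congrArg (fun θ : MvPolynomial σ A →+* TruncPoly τ B n => θ q) key

end BaseChange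

/-- A (commutative, one-dimensional) `n`-bud law over `A`: an element `F(T₁,T₂)` of
`A[T₁,T₂]/(T₁,T₂)^(n+1)` satisfying the identity, associativity and commutativity axioms.
(The identity axiom forces the constant term of `F` to vanish.) -/
@[ext]
structure BudLaw (A : Type) [CommRing A] (n : ℕ) where
  law : Aug (Fin 2) A n
  right_id : subst ![var (), 0] law = (var () : Aug Unit A n)
  left_id : subst ![0, var ()] law = (var () : Aug Unit A n)
  assoc : subst ![subst ![var 0, var 1] law, var 2] law =
    (subst ![var 0, subst ![var 1, var 2] law] law : Aug (Fin 3) A n)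
  comm : subst ![var 1, var 0] law = law

/-- A homomorphism of `n`-bud laws `F → G`: an element `f(T)` of `A[T]/(T)^(n+1)` with constant
term `0` such that `f(F(T₁,T₂)) = G(f(T₁),f(T₂))` in `A[T₁,T₂]/(T₁,T₂)^(n+1)`. -/
@[ext]
structure BudHom {A : Type} [CommRing A] {n : ℕ} (F G : BudLaw A n) where
  series : Aug Unit A n
  hom : subst (fun _ => F.law) series =
    subst ![subst (fun _ => var 0) series, subst (fun _ => var 1) series] G.law

section Hom

variable {A : Type} [CommRing A] {n : ℕ}

/-- The composite `(g ∘ f)(T) = g(f(T))`. -/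
def BudHom.comp {F G K : BudLaw A n} (g : BudHom G K) (f : BudHom F G) : BudHom F K where
  series := subst (fun _ => f.series) g.series
  hom := by
    have h2 := congrArg (subst (![subst (fun _ => var 0) f.series,
      subst (fun _ => var 1) f.series] : Fin 2 → Aug (Fin 2) A n)) g.hom
    rw [subst_subst, subst_subst] at h2
    rw [subst_subst, f.hom, h2]
    congr 1
    funext i
    fin_cases i <;> simp [subst_subst]

/-- The identity `id(T) = T`. -/
def BudHom.id (F : BudLaw A n) : BudHom F F where
  series := var ()
  hom := by
    simp only [subst_var]
    rw [show (![var 0, var 1] : Fin 2 → Aug (Fin 2) A n) = var by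
      funext i; fin_cases i <;> rfl, subst_self]

instance (F : BudLaw A n) : Mul (BudHom F F) := ⟨BudHom.comp⟩

instance (F : BudLaw A n) : One (BudHom F F) := ⟨BudHom.id F⟩

lemma BudHom.mul_series {F : BudLaw A n} (g f : BudHom F F) :
    (g * f).series = subst (fun _ => f.series) g.series := rfl

lemma BudHom.one_series {F : BudLaw A n} : (1 : BudHom F F).series = var () := rfl

/-- The monoid `End_A(F)` of endomorphisms of a bud law, under composition. -/
instance (F : BudLaw A n) : Monoid (BudHom F F) where
  mul_assoc a b c := BudHom.ext (by simp only [BudHom.mul_series, subst_subst])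
  one_mul a := BudHom.ext (by rw [BudHom.mul_series, BudHom.one_series, subst_var])
  mul_one a := BudHom.ext (by
    rw [BudHom.mul_series, BudHom.one_series]
    exact subst_self a.series)

/-- The group `Aut_A(F)` of automorphisms of a bud law. -/
abbrev BudAut (F : BudLaw A n) : Type := (BudHom F F)ˣ

end Hom

section MapHom

variable {A B C : Type} [CommRing A] [CommRing B] [CommRing C] {n : ℕ}

lemma comp_vec2 {α β : Type} (f : α → β) (a b : α) :
    (fun i => f (![a, b] i)) = ![f a, f b] := by
  funext i; fin_cases i <;> rfl

/-- The bud law `φ_* F` obtained by applying `φ` to the coefficients of `F`. -/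
def BudLaw.map (φ : A →+* B) (F : BudLaw A n) : BudLaw B n where
  law := mapAug φ F.law
  right_id := by
    simpa [mapAug_subst, comp_vec2 (mapAug φ)] using congrArg (mapAug φ) F.right_id
  left_id := by
    simpa [mapAug_subst, comp_vec2 (mapAug φ)] using congrArg (mapAug φ) F.left_id
  assoc := by
    simpa [mapAug_subst, comp_vec2 (mapAug φ)] using congrArg (mapAug φ) F.assoc
  comm := by
    simpa [mapAug_subst, comp_vec2 (mapAug φ)] using congrArg (mapAug φ) F.comm

/-- Base change `End_A(F) → End_B(φ_* F)`, `φ` applied to coefficients. (The law `φ_* F` enters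
through an equation so that base changes can be composed.) -/
def BudHom.mapMonoidHom (φ : A →+* B) {F : BudLaw A n} {G : BudLaw B n} (hG : G = F.map φ) :
    BudHom F F →* BudHom G G where
  toFun f :=
    { series := mapAug φ f.series
      hom := by
        subst hG
        simpa [BudLaw.map, mapAug_subst, comp_vec2 (mapAug φ)] using
          congrArg (mapAug φ) f.hom }
  map_one' := BudHom.ext (by simp [BudHom.one_series])
  map_mul' g f := BudHom.ext (by simp [BudHom.mul_series, mapAug_subst])

/-- Base change `Aut_A(F) → Aut_B(φ_* F)`. -/
def BudAut.map (φ : A →+* B) {F : BudLaw A n} {G : BudLaw B n} (hG : G = F.map φ) :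
    BudAut F →* BudAut G :=
  Units.map (BudHom.mapMonoidHom φ hG)

lemma BudLaw.map_map (ψ : B →+* C) (φ : A →+* B) (F : BudLaw A n) :
    (F.map φ).map ψ = F.map (ψ.comp φ) :=
  BudLaw.ext (mapAug_mapAug ψ φ F.law)

lemma BudAut.map_id {F : BudLaw A n} (hF : F = F.map (RingHom.id A)) :
    BudAut.map (RingHom.id A) hF = MonoidHom.id (BudAut F) := by
  ext x : 2
  exact BudHom.ext (mapAug_id _)

lemma BudAut.map_comp (ψ : B →+* C) (φ : A →+* B) (χ : A →+* C) (hχ : χ = ψ.comp φ)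
    {F : BudLaw A n} {G : BudLaw B n} {K : BudLaw C n}
    (hG : G = F.map φ) (hK : K = G.map ψ) (hK' : K = F.map χ) :
    BudAut.map χ hK' = (BudAut.map ψ hK).comp (BudAut.map φ hG) := by
  subst hχ
  ext x : 2
  exact BudHom.ext (mapAug_mapAug _ _ _).symm

end MapHom

section Truncation

variable {σ τ : Type} [Finite σ] [Finite τ] {R : Type} [CommRing R]

/-- Discarding the terms of degree `≥ n+1` of a power series without constant term. -/
def truncAug (n : ℕ) (f : MvPowerSeries σ R) (hf : f.constantCoeff = 0) : Aug σ R n :=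
  ⟨Ideal.Quotient.mk _ (f.truncTotal (n + 1)), by
    apply Ideal.mem_map_of_mem
    rw [← pow_one (MvPolynomial.idealOfVars σ R), MvPolynomial.mem_pow_idealOfVars_iff']
    intro x hx
    have hx0 : x = 0 := by simpa [Finsupp.degree_eq_zero_iff] using hx
    subst hx0
    rw [MvPowerSeries.coeff_truncTotal _ (by simp)]
    simpa using hf⟩

lemma truncAug_congr {n : ℕ} {f g : MvPowerSeries σ R} (h : f = g) (hf : f.constantCoeff = 0)
    (hg : g.constantCoeff = 0) : truncAug n f hf = truncAug n g hg := by
  subst h; rfl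

lemma truncAug_X {n : ℕ} (i : σ) (h : (MvPowerSeries.X i : MvPowerSeries σ R).constantCoeff = 0) :
    truncAug n (MvPowerSeries.X i) h = var i := by
  apply Subtype.ext
  simp only [truncAug, var]
  rw [Ideal.Quotient.eq, MvPolynomial.mem_pow_idealOfVars_iff']
  intro x hx
  rw [MvPolynomial.coeff_sub, MvPowerSeries.coeff_truncTotal _ hx,
    ← MvPolynomial.coeff_coe, MvPolynomial.coe_X, sub_self]

lemma truncAug_zero {n : ℕ} (h : (0 : MvPowerSeries σ R).constantCoeff = 0) :
    truncAug n (0 : MvPowerSeries σ R) h = 0 := by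
  apply Subtype.ext
  simp [truncAug]

/-- Truncation is compatible with substitution. -/
lemma truncAug_subst {n : ℕ} (a : σ → MvPowerSeries τ R) (ha : ∀ i, (a i).constantCoeff = 0)
    (f : MvPowerSeries σ R) (hf : f.constantCoeff = 0)
    (hs : (f.subst a).constantCoeff = 0) :
    truncAug n (f.subst a) hs = subst (fun i => truncAug n (a i) (ha i)) (truncAug n f hf) := by
  apply Subtype.ext
  simp only [truncAug, coe_subst, substAlgHom_mk]
  rw [MvPowerSeries.truncTotal_subst ha, MvPowerSeries.subst_coe]
  set b : σ → MvPolynomial τ R := fun i => (a i).truncTotal (n + 1)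
  set q := f.truncTotal (n + 1)
  have h1 : MvPolynomial.aeval (fun i => ((b i : MvPolynomial τ R) : MvPowerSeries τ R)) q =
      ((MvPolynomial.aeval b q : MvPolynomial τ R) : MvPowerSeries τ R) := by
    have := MvPolynomial.comp_aeval (R := R) b (MvPolynomial.coeToMvPowerSeries.algHom R (σ := τ))
    have := congrArg (fun θ => θ q) this
    simpa using this.symm
  rw [h1]
  have h2 : (Ideal.Quotient.mk (MvPolynomial.idealOfVars τ R ^ (n + 1)))
      (MvPowerSeries.truncTotal (n + 1)
        ((MvPolynomial.aeval b q : MvPolynomial τ R) : MvPowerSeries τ R)) =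
      Ideal.Quotient.mk _ (MvPolynomial.aeval b q) := by
    rw [Ideal.Quotient.eq, MvPolynomial.mem_pow_idealOfVars_iff']
    intro x hx
    rw [MvPolynomial.coeff_sub, MvPowerSeries.coeff_truncTotal _ hx,
      MvPolynomial.coeff_coe, sub_self]
  rw [h2]
  have := MvPolynomial.comp_aeval (R := R) b
    (Ideal.Quotient.mkₐ R (MvPolynomial.idealOfVars τ R ^ (n + 1)))
  exact congrArg (fun θ => θ q) this

end Truncation

section FormalGroupLaw

variable {R : Type} [CommRing R]

/-- The series `[m]_F(T) = F(⋯F(F(T,T),T)⋯,T)` (`m` copies of `T`), that is `[0]_F = 0` and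
`[m+1]_F(T) = F([m]_F(T),T)`. -/
def mulSeries (F : FormalGroup R) : ℕ → PowerSeries R
  | 0 => 0
  | m + 1 => F.toPowerSeries.subst ![mulSeries F m, PowerSeries.X]

lemma truncAug_subst_two {τ : Type} [Finite τ] {n : ℕ} (a b : MvPowerSeries τ R)
    (ha : a.constantCoeff = 0) (hb : b.constantCoeff = 0)
    (f : MvPowerSeries (Fin 2) R) (hf : f.constantCoeff = 0)
    (hs : (f.subst ![a, b]).constantCoeff = 0) :
    truncAug n (f.subst ![a, b]) hs = subst ![truncAug n a ha, truncAug n b hb]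
      (truncAug n f hf) := by
  have h : ∀ i, ((![a, b] : Fin 2 → MvPowerSeries τ R) i).constantCoeff = 0 := by
    intro i; fin_cases i <;> assumption
  rw [truncAug_subst ![a, b] h f hf hs]
  congr 1
  funext i
  fin_cases i <;> rfl

lemma constantCoeff_subst_two {τ : Type} (a b : MvPowerSeries τ R)
    (ha : a.constantCoeff = 0) (hb : b.constantCoeff = 0)
    (f : MvPowerSeries (Fin 2) R) (hf : f.constantCoeff = 0) :
    (f.subst ![a, b]).constantCoeff = 0 := by
  have h : ∀ i, ((![a, b] : Fin 2 → MvPowerSeries τ R) i).constantCoeff = 0 := by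
    intro i; fin_cases i <;> assumption
  exact MvPowerSeries.constantCoeff_subst_eq_zero
    (MvPowerSeries.hasSubst_of_constantCoeff_zero h) h hf

/-- The `n`-bud law `F^(n)` obtained from a commutative formal group law `F` by discarding the
terms of degree `≥ n+1`. -/
def truncLaw (F : FormalGroup R) [F.IsComm] (n : ℕ) : BudLaw R n where
  law := truncAug n F.toPowerSeries F.zero_constantCoeff
  right_id := by
    have hX : (MvPowerSeries.X () : MvPowerSeries Unit R).constantCoeff = 0 := by simp
    have h0 : (0 : MvPowerSeries Unit R).constantCoeff = 0 := map_zero _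
    have hs := constantCoeff_subst_two _ 0 hX h0 _ F.zero_constantCoeff
    have h := truncAug_subst_two (n := n) _ 0 hX h0 _ F.zero_constantCoeff hs
    rw [truncAug_X, truncAug_zero] at h
    rw [← h]
    exact (truncAug_congr F.Xzero_eq_X hs hX).trans (truncAug_X () hX)
  left_id := by
    have hX : (MvPowerSeries.X () : MvPowerSeries Unit R).constantCoeff = 0 := by simp
    have h0 : (0 : MvPowerSeries Unit R).constantCoeff = 0 := map_zero _
    have hs := constantCoeff_subst_two 0 _ h0 hX _ F.zero_constantCoeff
    have h := truncAug_subst_two (n := n) 0 _ h0 hX _ F.zero_constantCoeff hs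
    rw [truncAug_X, truncAug_zero] at h
    rw [← h]
    exact (truncAug_congr F.zeroX_eq_X hs hX).trans (truncAug_X () hX)
  assoc := by
    have hX : ∀ i : Fin 3, (MvPowerSeries.X i : MvPowerSeries (Fin 3) R).constantCoeff = 0 := by
      simp
    have h01 := constantCoeff_subst_two _ _ (hX 0) (hX 1) _ F.zero_constantCoeff
    have h12 := constantCoeff_subst_two _ _ (hX 1) (hX 2) _ F.zero_constantCoeff
    have hl := constantCoeff_subst_two _ _ h01 (hX 2) _ F.zero_constantCoeff
    have hr := constantCoeff_subst_two _ _ (hX 0) h12 _ F.zero_constantCoeff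
    have el := truncAug_subst_two (n := n) _ _ h01 (hX 2) _ F.zero_constantCoeff hl
    have er := truncAug_subst_two (n := n) _ _ (hX 0) h12 _ F.zero_constantCoeff hr
    have e01 := truncAug_subst_two (n := n) _ _ (hX 0) (hX 1) _ F.zero_constantCoeff h01
    have e12 := truncAug_subst_two (n := n) _ _ (hX 1) (hX 2) _ F.zero_constantCoeff h12
    simp only [truncAug_X] at el er e01 e12
    rw [← e01, ← e12, ← el, ← er]
    exact truncAug_congr F.assoc _ _
  comm := by
    have hX : ∀ i : Fin 2, (MvPowerSeries.X i : MvPowerSeries (Fin 2) R).constantCoeff = 0 := by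
      simp
    have hs := constantCoeff_subst_two _ _ (hX 1) (hX 0) _ F.zero_constantCoeff
    have h := truncAug_subst_two (n := n) _ _ (hX 1) (hX 0) _ F.zero_constantCoeff hs
    simp only [truncAug_X] at h
    rw [← h]
    exact truncAug_congr FormalGroup.IsComm.comm.symm _ _

end FormalGroupLaw

section AutFunctor

variable {k : Type} [CommRing k] {n : ℕ}

/-- For a scheme `S` over `Spec k`, the structure map `k → Γ(S, 𝒪_S)`. -/
def structureMap (S : Over (Spec (CommRingCat.of k))) : k →+* Γ(S.left, ⊤) :=
  ((Scheme.ΓSpecIso (CommRingCat.of k)).inv ≫ S.hom.appTop).hom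

lemma structureMap_comp {S T : Over (Spec (CommRingCat.of k))} (f : T ⟶ S) :
    structureMap T = f.left.appTop.hom.comp (structureMap S) := by
  have h : T.hom.appTop = S.hom.appTop ≫ f.left.appTop := by
    rw [← Scheme.Hom.comp_appTop, Over.w]
  simp [structureMap, h, RingHom.comp_assoc]

/-- The presheaf of groups `Aut(F) : S ↦ Aut_{Γ(S)}(F)` on the category of schemes over `Spec k`,
for an `n`-bud law `F` over `k`; restriction is base change of coefficients. -/
def autFunctor (F : BudLaw k n) : (Over (Spec (CommRingCat.of k)))ᵒᵖ ⥤ GrpCat.{0} where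
  obj S := GrpCat.of (BudAut (F.map (structureMap S.unop)))
  map {S T} f := GrpCat.ofHom (BudAut.map f.unop.left.appTop.hom (by
    rw [BudLaw.map_map, ← structureMap_comp]))
  map_id S := by
    ext x
    exact congrArg Subtype.val (mapAug_id x.val.series)
  map_comp {S T U} f g := by
    ext x
    exact congrArg Subtype.val (mapAug_mapAug g.unop.left.appTop.hom f.unop.left.appTop.hom
      x.val.series).symm

end AutFunctor

end FormalBud

end

noncomputable section

namespace FormalBud

/-! ### Binomial coefficients modulo `p` and symmetric `2`-cocycles -/

section Cocycle

/-! Write `q = p ^ h`. An endomorphism `f = ∑ a_i T^i` of the bud law is determined by its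
coefficients at the powers of `p` that are at most `n`. Those with `q * p ^ j ≤ n` satisfy `a ^ q =
a`, and the remaining ones, exactly `h` in number, are arbitrary. An automorphism has in addition
`a_1` invertible, so `a_1 ^ (q - 1) = 1`. The automorphism functor is thus an étale scheme times
affine `h`-space, which is smooth of dimension `h`.

The argument is obstruction theory in the style of Lazard. The defect `f(F(x,y)) - F(f(x),f(y))`, if
of order at least `m`, has as leading form a symmetric 2-cocycle of degree `m`
(`isSymmCocycle_defectCoeff`). If `m` is not a power of `p`, such a cocycle is a multiple of
`(x+y)^m - x^m - y^m` up to pure powers (`eq_mul_choose`), so one change of `a_m` removes it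
(`exists_defect_mem_succ`); the same unit binomial coefficient makes `a_m` unique
(`eq_of_defect_eq_zero`).

If `m > 1` is a power of `p`, the form is `c` times `((x+y)^m - x^m - y^m)/p` (`eq_mul_choose_div`),
and changing `a_m` does not affect it. Here `[p]` decides: the coefficient of `T^m` in `f([p](T)) -
[p](f(T))` is `-c` (`ev_mulBy_sub_mem`, `sum_choose_div_mul_pow`). Since `[p](T) = T^q`, this
difference is `∑ (a_i - a_i^q) T^(q i)` (`ev_mulBy_sub_eq_sum`). So the obstruction in degree `m`
vanishes exactly when `a_(m/q)^q = a_(m/q)`, and is absent when `q` does not divide `m`. -/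

lemma choose_mul_pow_add_modEq_one (p : ℕ) [Fact p.Prime] (c : ℕ) :
    ∀ k r : ℕ, r < p ^ k → (c * p ^ k + r).choose r ≡ 1 [MOD p]
  | 0, r, hr => by
    obtain rfl : r = 0 := by simpa using hr
    simp [Nat.ModEq.refl]
  | k + 1, r, hr => by
    have hp := (Fact.out : p.Prime).pos
    -- Lucas: the lowest `p`-adic digits of top and bottom both equal that of `r`, hence contribute
    -- `1`; recurse on the remaining digits.
    refine (Choose.choose_modEq_choose_mod_mul_choose_div_nat (p := p)).trans ?_
    have e : c * p ^ (k + 1) + r = p * (c * p ^ k) + r := by ring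
    have h1 : (c * p ^ (k + 1) + r) % p = r % p := by rw [e, Nat.mul_add_mod]
    have h2 : (c * p ^ (k + 1) + r) / p = c * p ^ k + r / p := by
      rw [e, Nat.mul_add_div hp]
    rw [h1, h2, Nat.choose_self, one_mul]
    refine choose_mul_pow_add_modEq_one p c k _ ?_
    rw [Nat.div_lt_iff_lt_mul hp, ← pow_succ]
    exact hr

lemma choose_pow_mul_modEq (p : ℕ) [Fact p.Prime] (k t : ℕ) :
    (p ^ k * t).choose (p ^ k) ≡ t [MOD p] := by
  simpa using Choose.choose_pow_mul_pow_mul_modEq_choose_nat (p := p) (k := k) (a := t) (b := 1)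

lemma isUnit_natCast_of_not_dvd (p : ℕ) [Fact p.Prime] (A : Type) [CommRing A]
    [Algebra (ZMod p) A] {a : ℕ} (ha : ¬ p ∣ a) : IsUnit (a : A) := by
  have h : IsUnit (a : ZMod p) := by
    rw [isUnit_iff_ne_zero, Ne, ZMod.natCast_eq_zero_iff]
    exact ha
  simpa using h.map (algebraMap (ZMod p) A)

lemma natCast_eq_of_modEq (p : ℕ) [Fact p.Prime] (A : Type) [CommRing A]
    [Algebra (ZMod p) A] {a b : ℕ} (hab : a ≡ b [MOD p]) : (a : A) = b := by
  have h : (a : ZMod p) = b := (ZMod.natCast_eq_natCast_iff _ _ _).2 hab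
  simpa using congrArg (algebraMap (ZMod p) A) h

/-- The coefficients of `x^i y^(m-i)` of a homogeneous symmetric polynomial `Γ` of degree `m`
with `Γ(x,y) + Γ(x+y,z) = Γ(y,z) + Γ(x,y+z)`. -/
structure IsSymmCocycle {A : Type} [CommRing A] (m : ℕ) (g : ℕ → A) : Prop where
  symm : ∀ i j, i + j = m → g i = g j
  cocycle : ∀ i j k, 0 < i → 0 < j → 0 < k → i + j + k = m →
    ((i + j).choose i : A) * g (i + j) = ((j + k).choose j : A) * g i

variable {A : Type} [CommRing A] {m : ℕ}

lemma IsSymmCocycle.sub_mul {g g' : ℕ → A} (hg : IsSymmCocycle m g) (hg' : IsSymmCocycle m g')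
    (c : A) : IsSymmCocycle m (fun i => g i - c * g' i) where
  symm i j hij := by simp only [hg.symm i j hij, hg'.symm i j hij]
  cocycle i j k hi hj hk h := by
    linear_combination hg.cocycle i j k hi hj hk h - c * hg'.cocycle i j k hi hj hk h

/-- Both sides are the trinomial coefficient `m! / (i! j! k!)`. -/
lemma choose_mul_choose_cocycle {i j k m : ℕ} (h : i + j + k = m) :
    (i + j).choose i * m.choose (i + j) = (j + k).choose j * m.choose i := by
  have h1 := Nat.choose_mul (n := m) (k := i + j) (s := i) (by lia)
  rw [show m - i = j + k by lia, show i + j - i = j by lia] at h1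
  linarith

/-- This is the coboundary of `T^m`; its two end coefficients do not enter the cocycle identity. -/
lemma isSymmCocycle_choose (A : Type) [CommRing A] (m : ℕ) :
    IsSymmCocycle m (fun i => (m.choose i : A)) where
  symm i j hij := by
    rw [← Nat.choose_symm_of_eq_add hij.symm]
  cocycle i j k _ _ _ h := by exact_mod_cast congrArg (Nat.cast : ℕ → A) (choose_mul_choose_cocycle h)

/-- The trinomial identity can be divided by `p` over `ℕ` before passing to `A`. In characteristic
`p` the resulting cocycle survives although the coboundary of `T^(p^k)` is zero. -/
lemma isSymmCocycle_choose_div (p : ℕ) [Fact p.Prime] (A : Type) [CommRing A] (k : ℕ) :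
    IsSymmCocycle (p ^ k) (fun i => (((p ^ k).choose i / p : ℕ) : A)) where
  symm i j hij := by
    rw [← Nat.choose_symm_of_eq_add hij.symm]
  cocycle i j l hi hj hl h := by
    have hp : p.Prime := Fact.out
    have d1 : p ∣ (p ^ k).choose (i + j) := hp.dvd_choose_pow (by lia) (by lia)
    have d2 : p ∣ (p ^ k).choose i := hp.dvd_choose_pow (by lia) (by lia)
    have := choose_mul_choose_cocycle h
    have e : (i + j).choose i * ((p ^ k).choose (i + j) / p) =
        (j + l).choose j * ((p ^ k).choose i / p) := by
      rw [← Nat.mul_div_assoc _ d1, ← Nat.mul_div_assoc _ d2, this]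
    exact_mod_cast congrArg (Nat.cast : ℕ → A) e

variable (p : ℕ) [Fact p.Prime] [Algebra (ZMod p) A]

/-- With `i = p^v t` and `p ∤ t`, the cocycle identity for `(p^v, i - p^v, m - i)` expresses
`i.choose (p^v) * g i` through `g (p^v)`, and this binomial coefficient is `t` modulo `p`, a unit.
-/
lemma IsSymmCocycle.eq_zero_of_pow {g : ℕ → A} (hg : IsSymmCocycle m g) {i : ℕ} (hi : 0 < i)
    (him : i < m) (h0 : g (p ^ i.factorization p) = 0) : g i = 0 := by
  have hp : p.Prime := Fact.out
  set v := i.factorization p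
  set t := i / p ^ v
  have hit : p ^ v * t = i := Nat.ordProj_mul_ordCompl_eq_self i p
  have ht : ¬ p ∣ t := Nat.not_dvd_ordCompl hp hi.ne'
  have hpv : 0 < p ^ v := pow_pos hp.pos _
  by_cases h1 : i = p ^ v
  · rw [h1]; exact h0
  have hlt : p ^ v < i := lt_of_le_of_ne (Nat.le_of_dvd hi ⟨t, hit.symm⟩) (Ne.symm h1)
  have hc := hg.cocycle (p ^ v) (i - p ^ v) (m - i) hpv (by lia) (by lia) (by lia)
  rw [h0, mul_zero, show p ^ v + (i - p ^ v) = i by lia] at hc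
  have hu : IsUnit ((i.choose (p ^ v) : ℕ) : A) := by
    have h2 := choose_pow_mul_modEq p v t
    rw [hit] at h2
    rw [natCast_eq_of_modEq p A h2]
    exact isUnit_natCast_of_not_dvd p A ht
  exact hu.mul_right_eq_zero.1 hc

/-- A symmetric `2`-cocycle of degree `m = p^k s` vanishes if its coefficient at `p^k` does. -/
lemma IsSymmCocycle.eq_zero {g : ℕ → A} (hg : IsSymmCocycle m g) {k s : ℕ} (hm : m = p ^ k * s)
    (hs : 2 ≤ s) (hps : s = p ∨ ¬ p ∣ s) (h0 : g (p ^ k) = 0) {i : ℕ} (hi : 0 < i)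
    (him : i < m) : g i = 0 := by
  have hp : p.Prime := Fact.out
  have hpk : 0 < p ^ k := pow_pos hp.pos _
  have key : ∀ e, p ^ e < m → g (p ^ e) = 0 := by
    intro e he
    have hpe : 0 < p ^ e := pow_pos hp.pos _
    rcases lt_trichotomy e k with hek | rfl | hek
    · have hlt : p ^ e < p ^ k := Nat.pow_lt_pow_right hp.one_lt hek
      have hkm : p ^ k < m := by rw [hm]; nlinarith
      -- This triple relates `g (p^e)` to `g (p^k) = 0`; the factor of `g (p^e)` is `((s-1) p^k +
      -- (p^k - p^e)).choose (p^k - p^e)`, which is `1` modulo `p`.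
      have hc := hg.cocycle (p ^ e) (p ^ k - p ^ e) (m - p ^ k) hpe (by lia) (by lia) (by lia)
      rw [show p ^ e + (p ^ k - p ^ e) = p ^ k by lia, h0, mul_zero,
        show p ^ k - p ^ e + (m - p ^ k) = (s - 1) * p ^ k + (p ^ k - p ^ e) by
          obtain ⟨t, rfl⟩ : ∃ t, s = t + 1 := ⟨s - 1, by lia⟩
          rw [hm, Nat.add_sub_cancel]
          have : p ^ k * (t + 1) - p ^ k = t * p ^ k := by
            rw [mul_add, mul_one, Nat.add_sub_cancel, mul_comm]
          lia,
        natCast_eq_of_modEq p A (choose_mul_pow_add_modEq_one p (s - 1) k _ (by lia))] at hc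
      simpa using hc.symm
    · exact h0
    · rcases hps with rfl | hps
      · rw [hm, ← pow_succ] at he
        have := (Nat.pow_lt_pow_iff_right hp.one_lt).1 he
        lia
      -- By symmetry it suffices to treat `m - p^e = p^k (s - p^(e-k))`, whose `p`-adic valuation is
      -- exactly `k` because `p ∤ s`.
      · rw [hg.symm (p ^ e) (m - p ^ e) (by lia)]
        refine hg.eq_zero_of_pow p (by lia) (by lia) ?_
        have hd : p ∣ p ^ (e - k) := dvd_pow_self p (by lia)
        have he2 : m - p ^ e = p ^ k * (s - p ^ (e - k)) := by
          rw [Nat.mul_sub, ← hm, ← pow_add, show k + (e - k) = e by lia]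
        have hlt : p ^ (e - k) < s := by
          by_contra hcon
          have := Nat.mul_le_mul_left (p ^ k) (not_lt.1 hcon)
          rw [← hm, ← pow_add, show k + (e - k) = e by lia] at this
          lia
        have hnd : ¬ p ∣ s - p ^ (e - k) := fun h3 => hps (by
          have := (Nat.dvd_add h3 hd); rwa [Nat.sub_add_cancel hlt.le] at this)
        have : (m - p ^ e).factorization p = k := by
          rw [he2, Nat.factorization_mul hpk.ne' (by lia)]
          simp [Nat.factorization_eq_zero_of_not_dvd hnd, hp.factorization_self]
        rw [this, h0]
  refine hg.eq_zero_of_pow p hi him (key _ (lt_of_le_of_lt ?_ him))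
  exact Nat.ordProj_le p hi.ne'

/-- The coefficient `m.choose (p^k)` is `s` modulo `p`, a unit. So a multiple of the coboundary
matches `g` at `p^k`, and `eq_zero` applies to the difference. -/
lemma IsSymmCocycle.eq_mul_choose {g : ℕ → A} (hg : IsSymmCocycle m g) {k s : ℕ}
    (hm : m = p ^ k * s) (hs : 2 ≤ s) (hps : ¬ p ∣ s) :
    ∃ c : A, ∀ i, 0 < i → i < m → g i = c * (m.choose i : A) := by
  obtain ⟨u, hu⟩ : IsUnit ((m.choose (p ^ k) : ℕ) : A) := by
    rw [hm, natCast_eq_of_modEq p A (choose_pow_mul_modEq p k s)]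
    exact isUnit_natCast_of_not_dvd p A hps
  refine ⟨g (p ^ k) * ↑u⁻¹, fun i hi him => sub_eq_zero.1 ?_⟩
  refine (hg.sub_mul (isSymmCocycle_choose A m) _).eq_zero p hm hs (Or.inr hps) ?_ hi him
  simp only [← hu, mul_assoc, Units.inv_mul, mul_one, sub_self]

/-- The same argument with the divided cocycle, whose coefficient at `p^k` is `(p^(k+1) - 1).choose
(p^k - 1)`, congruent to `1` modulo `p`. -/
lemma IsSymmCocycle.eq_mul_choose_div {k : ℕ} {g : ℕ → A} (hg : IsSymmCocycle (p ^ (k + 1)) g) :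
    ∃ c : A, ∀ i, 0 < i → i < p ^ (k + 1) → g i = c * (((p ^ (k + 1)).choose i / p : ℕ) : A) := by
  have hp : p.Prime := Fact.out
  have hu : IsUnit ((((p ^ (k + 1)).choose (p ^ k) / p : ℕ)) : A) := by
    have h1 := Choose.choose_pow_mul_pow_mul_modEq_choose_nat (p := p) (k := k) (a := p) (b := 1)
    have h2 : (p ^ (k + 1)).choose (p ^ k) = p * (p ^ (k + 1) - 1).choose (p ^ k - 1) := by
      have := Nat.add_one_mul_choose_eq (p ^ (k + 1) - 1) (p ^ k - 1)
      rw [Nat.sub_add_cancel (Nat.pos_of_ne_zero (pow_ne_zero _ hp.ne_zero)),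
        Nat.sub_add_cancel (Nat.pos_of_ne_zero (pow_ne_zero _ hp.ne_zero))] at this
      have hpk : 0 < p ^ k := pow_pos hp.pos _
      refine Nat.eq_of_mul_eq_mul_right hpk ?_
      rw [← this, pow_succ]; ring
    rw [h2, Nat.mul_div_cancel_left _ hp.pos]
    have hpk : 0 < p ^ k := pow_pos hp.pos _
    have h3 : p ^ (k + 1) - 1 = (p - 1) * p ^ k + (p ^ k - 1) := by
      have := hp.one_lt
      obtain ⟨r, rfl⟩ : ∃ r, p = r + 1 := ⟨p - 1, by lia⟩
      rw [pow_succ, Nat.add_sub_cancel, mul_add, mul_one, mul_comm r]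
      lia
    rw [h3, natCast_eq_of_modEq p A (choose_mul_pow_add_modEq_one p (p - 1) k _ (by lia))]
    simp
  obtain ⟨u, hu⟩ := hu
  refine ⟨g (p ^ k) * ↑u⁻¹, fun i hi him => sub_eq_zero.1 ?_⟩
  refine (hg.sub_mul (isSymmCocycle_choose_div p A (k + 1)) _).eq_zero p (pow_succ p k)
    hp.two_le (Or.inl rfl) ?_ hi him
  simp only [← hu, mul_assoc, Units.inv_mul, mul_one, sub_self]

end Cocycle

/-! ### Truncated polynomials: coefficients, orders and leading forms -/

section Order

variable {σ τ : Type} {A : Type} [CommRing A] {n m : ℕ}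

/-- The coefficient of `T^d` of a truncated polynomial (`0` if `d` has degree `> n`). -/
def tcoeff (d : σ →₀ ℕ) : TruncPoly σ A n →ₗ[A] A :=
  if h : d.degree ≤ n then
    (Submodule.liftQ ((MvPolynomial.idealOfVars σ A ^ (n + 1)).restrictScalars A)
      (MvPolynomial.lcoeff A d) (fun q hq =>
        (MvPolynomial.mem_pow_idealOfVars_iff' _ q).1 hq d (Nat.lt_succ_of_le h))).comp
      (Submodule.Quotient.restrictScalarsEquiv A _).symm.toLinearMap
  else 0

lemma tcoeff_mk {d : σ →₀ ℕ} (hd : d.degree ≤ n) (q : MvPolynomial σ A) :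
    tcoeff (n := n) d (Ideal.Quotient.mk _ q) = q.coeff d := by
  rw [tcoeff, dif_pos hd]
  rfl

lemma tcoeff_eq_zero {d : σ →₀ ℕ} (hd : ¬ d.degree ≤ n) (x : TruncPoly σ A n) :
    tcoeff d x = 0 := by
  rw [tcoeff, dif_neg hd]
  rfl

/-- For `m ≤ n + 1` the kernel of the quotient map lies in the `m`-th power of the ideal of the
variables, so the order can be read off from any representative. -/
lemma mk_mem_augIdeal_pow (hm : m ≤ n + 1) (q : MvPolynomial σ A) :
    (Ideal.Quotient.mk _ q : TruncPoly σ A n) ∈ augIdeal σ A n ^ m ↔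
      q ∈ MvPolynomial.idealOfVars σ A ^ m := by
  rw [augIdeal, ← Ideal.map_pow, Ideal.mem_map_iff_of_surjective _ Ideal.Quotient.mk_surjective]
  constructor
  · rintro ⟨r, hr, h⟩
    have h1 := Ideal.pow_le_pow_right hm (Ideal.Quotient.eq.1 h)
    simpa using sub_mem hr h1
  · exact fun h => ⟨q, h, rfl⟩

lemma mem_augIdeal_pow_iff (hm : m ≤ n + 1) (x : TruncPoly σ A n) :
    x ∈ augIdeal σ A n ^ m ↔ ∀ d : σ →₀ ℕ, d.degree < m → tcoeff d x = 0 := by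
  obtain ⟨q, rfl⟩ := Ideal.Quotient.mk_surjective x
  rw [mk_mem_augIdeal_pow hm, MvPolynomial.mem_pow_idealOfVars_iff']
  exact forall₂_congr fun d hd => by rw [tcoeff_mk (by lia)]

lemma tcoeff_eq_zero_of_mem {d : σ →₀ ℕ} (hd : d.degree < m) {x : TruncPoly σ A n}
    (hx : x ∈ augIdeal σ A n ^ m) : tcoeff d x = 0 := by
  by_cases h : d.degree ≤ n
  · exact (mem_augIdeal_pow_iff (m := d.degree + 1) (by lia) x).1
      (Ideal.pow_le_pow_right hd hx) d (by lia)
  · exact tcoeff_eq_zero h x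

lemma eq_of_sub_mem_pow {x y : TruncPoly σ A n} (h : x - y ∈ augIdeal σ A n ^ (n + 1)) :
    x = y := by
  rw [augIdeal_pow_eq_bot] at h
  exact sub_eq_zero.1 h

@[simp] lemma coe_var (i : σ) :
    ((var i : Aug σ A n) : TruncPoly σ A n) = Ideal.Quotient.mk _ (MvPolynomial.X i) := rfl

/-- The variable `T_i`, as a truncated polynomial. -/
abbrev gen (i : σ) : TruncPoly σ A n := (var i : Aug σ A n)

lemma substAlgHom_mem_pow (g : σ → Aug τ A n) {x : TruncPoly σ A n}
    (hx : x ∈ augIdeal σ A n ^ m) : substAlgHom g x ∈ augIdeal τ A n ^ m := by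
  have h : augIdeal σ A n ≤ (augIdeal τ A n).comap (substAlgHom g) :=
    fun y hy => substAlgHom_mem g hy
  exact Ideal.le_comap_pow _ _ (Ideal.pow_right_mono h m hx)

lemma substAlgHom_sub_mem {g g' : σ → Aug τ A n}
    (h : ∀ i, (g i - g' i : TruncPoly τ A n) ∈ augIdeal τ A n ^ m) (x : TruncPoly σ A n) :
    substAlgHom g x - substAlgHom g' x ∈ augIdeal τ A n ^ m := by
  obtain ⟨q, rfl⟩ := Ideal.Quotient.mk_surjective x
  simp only [substAlgHom_mk]
  induction q using MvPolynomial.induction_on with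
  | C a => simp
  | add q r hq hr =>
    have e : ∀ a b c d : TruncPoly τ A n, a + b - (c + d) = (a - c) + (b - d) := by
      intros; ring
    rw [map_add, map_add, e]
    exact add_mem hq hr
  | mul_X q i hq =>
    have e : ∀ a b c d : TruncPoly τ A n, a * b - c * d = a * (b - d) + d * (a - c) := by
      intros; ring
    rw [map_mul, map_mul, e]
    refine add_mem (Ideal.mul_mem_left _ _ ?_) (Ideal.mul_mem_left _ _ hq)
    simpa using h i

/-- Second order terms do not see perturbations to leading order. -/
lemma substAlgHom_sub_mem_succ {g g' : σ → Aug τ A n}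
    (h : ∀ i, (g i - g' i : TruncPoly τ A n) ∈ augIdeal τ A n ^ m) {x : TruncPoly σ A n}
    (hx : x ∈ augIdeal σ A n ^ 2) :
    substAlgHom g x - substAlgHom g' x ∈ augIdeal τ A n ^ (m + 1) := by
  rw [pow_two] at hx
  refine Submodule.mul_induction_on hx ?_ ?_
  · intro a ha b hb
    have e : ∀ a b c d : TruncPoly τ A n, a * b - c * d = (b - d) * a + (a - c) * d := by
      intros; ring
    rw [map_mul, map_mul, e, pow_succ (augIdeal τ A n) m]
    exact add_mem (Ideal.mul_mem_mul (substAlgHom_sub_mem h b) (substAlgHom_mem g ha))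
      (Ideal.mul_mem_mul (substAlgHom_sub_mem h a) (substAlgHom_mem g' hb))
  · intro a b ha hb
    have e : ∀ a b c d : TruncPoly τ A n, a + b - (c + d) = (a - c) + (b - d) := by
      intros; ring
    rw [map_add, map_add, e]
    exact add_mem ha hb

end Order

/-! ### Binary forms, their coefficients, and leading forms. -/

section Form

variable {σ τ : Type} {A : Type} [CommRing A] {n m : ℕ}

/-- The binary form `∑ g_i u^i v^(m-i)`. -/
def form {R : Type} [CommRing R] [Algebra A R] (m : ℕ) (g : ℕ → A) (u v : R) : R :=
  ∑ ab ∈ Finset.HasAntidiagonal.antidiagonal m, g ab.1 • (u ^ ab.1 * v ^ ab.2)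

lemma map_form {R S : Type} [CommRing R] [Algebra A R] [CommRing S] [Algebra A S]
    (φ : R →ₐ[A] S) (g : ℕ → A) (u v : R) : φ (form m g u v) = form m g (φ u) (φ v) := by
  simp [form]

lemma pow_sub_pow_mem {R : Type} [CommRing R] {J : Ideal R} {u u' : R} (hu : u ∈ J) (hu' : u' ∈ J)
    (h : u - u' ∈ J ^ 2) (a : ℕ) : u ^ a - u' ^ a ∈ J ^ (a + 1) := by
  induction a with
  | zero => simp
  | succ a ih =>
    have e : u ^ (a + 1) - u' ^ (a + 1) = (u ^ a - u' ^ a) * u + u' ^ a * (u - u') := by ring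
    rw [e]
    refine add_mem ?_ ?_
    · rw [pow_succ J]; exact Ideal.mul_mem_mul ih hu
    · rw [show a + 1 + 1 = a + 2 by rfl, pow_add]
      exact Ideal.mul_mem_mul (Ideal.pow_mem_pow hu' a) h

/-- Modulo order `m + 1`, a form of degree `m` sees its arguments only modulo `J ^ 2`. This allows
`F(x,y)` to be replaced by `x + y` inside a leading form. -/
lemma form_sub_mem {R : Type} [CommRing R] [Algebra A R] {J : Ideal R} {u u' v v' : R}
    (hu : u ∈ J) (hu' : u' ∈ J) (hv : v ∈ J) (hv' : v' ∈ J) (h : u - u' ∈ J ^ 2)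
    (h' : v - v' ∈ J ^ 2) (g : ℕ → A) : form m g u v - form m g u' v' ∈ J ^ (m + 1) := by
  rw [form, form, ← Finset.sum_sub_distrib]
  refine sum_mem fun ab hab => ?_
  rw [← smul_sub]
  refine Submodule.smul_of_tower_mem _ _ ?_
  have e : u ^ ab.1 * v ^ ab.2 - u' ^ ab.1 * v' ^ ab.2 =
      (u ^ ab.1 - u' ^ ab.1) * v ^ ab.2 + u' ^ ab.1 * (v ^ ab.2 - v' ^ ab.2) := by ring
  rw [e]
  refine add_mem ?_ ?_
  · rw [show m + 1 = (ab.1 + 1) + ab.2 by have := Finset.HasAntidiagonal.mem_antidiagonal.1 hab; lia, pow_add]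
    exact Ideal.mul_mem_mul (pow_sub_pow_mem hu hu' h _) (Ideal.pow_mem_pow hv _)
  · rw [show m + 1 = ab.1 + (ab.2 + 1) by have := Finset.HasAntidiagonal.mem_antidiagonal.1 hab; lia, pow_add]
    exact Ideal.mul_mem_mul (Ideal.pow_mem_pow hu' _) (pow_sub_pow_mem hv hv' h' _)

/-- The exponent `(i, j)` in two variables. -/
def fin2 (i j : ℕ) : Fin 2 →₀ ℕ := Finsupp.single 0 i + Finsupp.single 1 j

@[simp] lemma degree_fin2 (i j : ℕ) : (fin2 i j).degree = i + j := by simp [fin2]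

lemma fin2_eq_iff {i j : ℕ} {d : Fin 2 →₀ ℕ} : fin2 i j = d ↔ i = d 0 ∧ j = d 1 := by
  constructor
  · rintro rfl; simp [fin2]
  · rintro ⟨rfl, rfl⟩
    ext t; fin_cases t <;> simp [fin2]

lemma X_pow_mul_X_pow (i j : ℕ) : (MvPolynomial.X 0 ^ i * MvPolynomial.X 1 ^ j :
    MvPolynomial (Fin 2) A) = MvPolynomial.monomial (fin2 i j) 1 := by
  rw [MvPolynomial.X_pow_eq_monomial, MvPolynomial.X_pow_eq_monomial, MvPolynomial.monomial_mul,
    mul_one, fin2]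

lemma coeff_form (g : ℕ → A) (d : Fin 2 →₀ ℕ) :
    (form m g (MvPolynomial.X 0) (MvPolynomial.X 1) : MvPolynomial (Fin 2) A).coeff d =
      if d.degree = m then g (d 0) else 0 := by
  classical
  have hd : d.degree = d 0 + d 1 := by
    rw [← degree_fin2, (fin2_eq_iff (d := d)).2 ⟨rfl, rfl⟩]
  simp only [form, MvPolynomial.coeff_sum, X_pow_mul_X_pow, MvPolynomial.coeff_smul,
    MvPolynomial.coeff_monomial, smul_eq_mul, fin2_eq_iff, mul_ite, mul_one, mul_zero]
  split_ifs with h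
  · rw [Finset.sum_eq_single (d 0, d 1)]
    · simp
    · rintro ⟨a, b⟩ _ hab
      rw [if_neg]
      simpa using hab
    · intro hn
      exact absurd (Finset.HasAntidiagonal.mem_antidiagonal.2 (hd ▸ h)) hn
  · refine Finset.sum_eq_zero ?_
    rintro ⟨a, b⟩ hab
    rw [if_neg]
    rintro ⟨rfl, rfl⟩
    exact h (hd ▸ Finset.HasAntidiagonal.mem_antidiagonal.1 hab)

/-- The exponent `(i, j, k)` in three variables. -/
def fin3 (i j k : ℕ) : Fin 3 →₀ ℕ :=
  Finsupp.single 0 i + Finsupp.single 1 j + Finsupp.single 2 k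

@[simp] lemma degree_fin3 (i j k : ℕ) : (fin3 i j k).degree = i + j + k := by simp [fin3]

lemma fin3_inj {i j k i' j' k' : ℕ} :
    fin3 i j k = fin3 i' j' k' ↔ i = i' ∧ j = j' ∧ k = k' := by
  constructor
  · intro h
    have h0 := DFunLike.congr_fun h 0
    have h1 := DFunLike.congr_fun h 1
    have h2 := DFunLike.congr_fun h 2
    simp [fin3] at h0 h1 h2
    exact ⟨h0, h1, h2⟩
  · rintro ⟨rfl, rfl, rfl⟩; rfl

lemma coeff_X_pow_three (i j k a b c : ℕ) :
    (MvPolynomial.X 0 ^ a * MvPolynomial.X 1 ^ b * MvPolynomial.X 2 ^ c :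
      MvPolynomial (Fin 3) A).coeff (fin3 i j k) = if a = i ∧ b = j ∧ c = k then 1 else 0 := by
  classical
  have h : (MvPolynomial.X 0 ^ a * MvPolynomial.X 1 ^ b * MvPolynomial.X 2 ^ c :
      MvPolynomial (Fin 3) A) = MvPolynomial.monomial (fin3 a b c) 1 := by
    rw [MvPolynomial.X_pow_eq_monomial, MvPolynomial.X_pow_eq_monomial,
      MvPolynomial.X_pow_eq_monomial, MvPolynomial.monomial_mul, MvPolynomial.monomial_mul,
      mul_one, mul_one, fin3]
  rw [h, MvPolynomial.coeff_monomial]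
  exact if_congr (fin3_inj.trans Iff.rfl) rfl rfl

/-- Only the term with `(x+y)^(i+j) z^k` contributes to `x^i y^j z^k`. -/
lemma coeff_form_add_left {i j k : ℕ} (h : i + j + k = m) (g : ℕ → A) :
    (form m g (MvPolynomial.X 0 + MvPolynomial.X 1) (MvPolynomial.X 2) :
      MvPolynomial (Fin 3) A).coeff (fin3 i j k) = ((i + j).choose i : A) * g (i + j) := by
  classical
  have e : ∀ a b, ((MvPolynomial.X 0 + MvPolynomial.X 1) ^ a * MvPolynomial.X 2 ^ b :
      MvPolynomial (Fin 3) A).coeff (fin3 i j k) =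
        if a = i + j ∧ b = k then ((i + j).choose i : A) else 0 := by
    intro a b
    rw [(Commute.all _ _).add_pow', Finset.sum_mul, MvPolynomial.coeff_sum]
    simp only [smul_mul_assoc, MvPolynomial.coeff_smul, coeff_X_pow_three]
    split_ifs with hab
    · obtain ⟨rfl, rfl⟩ := hab
      rw [Finset.sum_eq_single (i, j)]
      · simp
      · rintro ⟨c, d⟩ _ hcd
        rw [if_neg, smul_zero]
        rintro ⟨rfl, rfl, -⟩
        exact hcd rfl
      · simp
    · refine Finset.sum_eq_zero ?_
      rintro ⟨c, d⟩ hcd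
      rw [if_neg, smul_zero]
      rintro ⟨rfl, rfl, h3⟩
      exact hab ⟨(Finset.HasAntidiagonal.mem_antidiagonal.1 hcd).symm, h3⟩
  simp only [form, MvPolynomial.coeff_sum, MvPolynomial.coeff_smul, e]
  rw [Finset.sum_eq_single (i + j, k)]
  · simp [mul_comm]
  · rintro ⟨a, b⟩ _ hab
    rw [if_neg, smul_zero]
    rintro ⟨rfl, rfl⟩
    exact hab rfl
  · intro hn
    exact absurd (Finset.HasAntidiagonal.mem_antidiagonal.2 h) hn

lemma coeff_form_add_right {i j k : ℕ} (h : i + j + k = m) (g : ℕ → A) :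
    (form m g (MvPolynomial.X 0) (MvPolynomial.X 1 + MvPolynomial.X 2) :
      MvPolynomial (Fin 3) A).coeff (fin3 i j k) = ((j + k).choose j : A) * g i := by
  classical
  have e : ∀ a b, (MvPolynomial.X 0 ^ a * (MvPolynomial.X 1 + MvPolynomial.X 2) ^ b :
      MvPolynomial (Fin 3) A).coeff (fin3 i j k) =
        if a = i ∧ b = j + k then ((j + k).choose j : A) else 0 := by
    intro a b
    rw [(Commute.all _ _).add_pow', Finset.mul_sum, MvPolynomial.coeff_sum]
    simp only [mul_smul_comm, MvPolynomial.coeff_smul, ← mul_assoc, coeff_X_pow_three]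
    split_ifs with hab
    · obtain ⟨rfl, rfl⟩ := hab
      rw [Finset.sum_eq_single (j, k)]
      · simp
      · rintro ⟨c, d⟩ _ hcd
        rw [if_neg, smul_zero]
        rintro ⟨-, rfl, rfl⟩
        exact hcd rfl
      · simp
    · refine Finset.sum_eq_zero ?_
      rintro ⟨c, d⟩ hcd
      rw [if_neg, smul_zero]
      rintro ⟨h3, rfl, rfl⟩
      exact hab ⟨h3, (Finset.HasAntidiagonal.mem_antidiagonal.1 hcd).symm⟩
  simp only [form, MvPolynomial.coeff_sum, MvPolynomial.coeff_smul, e]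
  rw [Finset.sum_eq_single (i, j + k)]
  · simp [mul_comm]
  · rintro ⟨a, b⟩ _ hab
    rw [if_neg, smul_zero]
    rintro ⟨rfl, rfl⟩
    exact hab rfl
  · intro hn
    exact absurd (Finset.HasAntidiagonal.mem_antidiagonal.2 (by lia)) hn

lemma coeff_form_zero_one {i j k : ℕ} (hk : 0 < k) (g : ℕ → A) :
    (form m g (MvPolynomial.X 0) (MvPolynomial.X 1) :
      MvPolynomial (Fin 3) A).coeff (fin3 i j k) = 0 := by
  simp only [form, MvPolynomial.coeff_sum, MvPolynomial.coeff_smul]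
  refine Finset.sum_eq_zero fun ab _ => ?_
  have := coeff_X_pow_three (A := A) i j k ab.1 ab.2 0
  rw [pow_zero, mul_one] at this
  rw [this, if_neg (by lia), smul_zero]

lemma coeff_form_one_two {i j k : ℕ} (hi : 0 < i) (g : ℕ → A) :
    (form m g (MvPolynomial.X 1) (MvPolynomial.X 2) :
      MvPolynomial (Fin 3) A).coeff (fin3 i j k) = 0 := by
  simp only [form, MvPolynomial.coeff_sum, MvPolynomial.coeff_smul]
  refine Finset.sum_eq_zero fun ab _ => ?_
  have := coeff_X_pow_three (A := A) i j k 0 ab.1 ab.2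
  rw [pow_zero, one_mul] at this
  rw [this, if_neg (by lia), smul_zero]

lemma mk_form {σ : Type} (g : ℕ → A) (u v : MvPolynomial σ A) :
    (Ideal.Quotient.mk _ (form m g u v) : TruncPoly σ A n) =
      form m g (Ideal.Quotient.mk _ u) (Ideal.Quotient.mk _ v) :=
  map_form (Ideal.Quotient.mkₐ A _) g u v

/-- The leading form of a truncated polynomial in two variables. -/
lemma sub_form_mem (hm : m ≤ n) {x : TruncPoly (Fin 2) A n} (hx : x ∈ augIdeal (Fin 2) A n ^ m) :
    x - form m (fun i => tcoeff (fin2 i (m - i)) x) (gen 0 : TruncPoly (Fin 2) A n)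
      (gen 1 : TruncPoly (Fin 2) A n) ∈ augIdeal (Fin 2) A n ^ (m + 1) := by
  obtain ⟨q, rfl⟩ := Ideal.Quotient.mk_surjective x
  rw [gen, gen, coe_var, coe_var, ← mk_form, ← map_sub, mk_mem_augIdeal_pow (by lia),
    MvPolynomial.mem_pow_idealOfVars_iff']
  intro d hd
  rw [mk_mem_augIdeal_pow (by lia), MvPolynomial.mem_pow_idealOfVars_iff'] at hx
  rw [MvPolynomial.coeff_sub, coeff_form]
  split_ifs with h
  · have hd2 : fin2 (d 0) (m - d 0) = d := by
      refine fin2_eq_iff.2 ⟨rfl, ?_⟩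
      have := degree_fin2 (d 0) (d 1)
      rw [(fin2_eq_iff (d := d)).2 ⟨rfl, rfl⟩] at this
      lia
    rw [tcoeff_mk (by rw [hd2]; lia), hd2, sub_self]
  · rw [hx d (by lia), sub_zero]

/-- If a cocycle identity holds to leading order, it holds for the leading form. -/
lemma isSymmCocycle_of_mem (hm : m ≤ n) (g : ℕ → A)
    (hs : form m g (gen 0 : TruncPoly (Fin 2) A n) (gen 1 : TruncPoly (Fin 2) A n) -
      form m g (gen 1 : TruncPoly (Fin 2) A n) (gen 0 : TruncPoly (Fin 2) A n) ∈
        augIdeal (Fin 2) A n ^ (m + 1))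
    (hc : form m g (gen 0 : TruncPoly (Fin 3) A n) (gen 1 : TruncPoly (Fin 3) A n) +
        form m g (gen 0 + gen 1 : TruncPoly (Fin 3) A n)
          (gen 2 : TruncPoly (Fin 3) A n) -
        form m g (gen 1 : TruncPoly (Fin 3) A n) (gen 2 : TruncPoly (Fin 3) A n) -
        form m g (gen 0 : TruncPoly (Fin 3) A n)
          (gen 1 + gen 2 : TruncPoly (Fin 3) A n) ∈
      augIdeal (Fin 3) A n ^ (m + 1)) : IsSymmCocycle m g where
  symm i j hij := by
    simp only [coe_var] at hs
    rw [← mk_form, ← mk_form, ← map_sub, mk_mem_augIdeal_pow (by lia),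
      MvPolynomial.mem_pow_idealOfVars_iff'] at hs
    have h := hs (fin2 i j) (by simp; lia)
    have hsw : (form m g (MvPolynomial.X 1) (MvPolynomial.X 0) : MvPolynomial (Fin 2) A) =
        form m (fun a => g (m - a)) (MvPolynomial.X 0) (MvPolynomial.X 1) := by
      rw [form, form, ← Finset.Nat.sum_antidiagonal_swap]
      refine Finset.sum_congr rfl fun ab hab => ?_
      rw [Prod.fst_swap, Prod.snd_swap, mul_comm,
        show m - ab.1 = ab.2 by have := Finset.HasAntidiagonal.mem_antidiagonal.1 hab; lia]
    rw [hsw, MvPolynomial.coeff_sub, coeff_form, coeff_form, degree_fin2, if_pos hij, if_pos hij,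
      sub_eq_zero] at h
    simpa [fin2, ← hij] using h
  cocycle i j k hi hj hk h := by
    simp only [coe_var, ← map_add, ← mk_form] at hc
    rw [← map_sub, ← map_sub, mk_mem_augIdeal_pow (by lia),
      MvPolynomial.mem_pow_idealOfVars_iff'] at hc
    -- In a monomial with all three exponents positive, the forms in `x, y` alone and in `y, z`
    -- alone have coefficient zero.
    have h2 := hc (fin3 i j k) (by simp; lia)
    rw [MvPolynomial.coeff_sub, MvPolynomial.coeff_sub, MvPolynomial.coeff_add,
      coeff_form_zero_one hk, coeff_form_one_two hi, coeff_form_add_left h,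
      coeff_form_add_right h] at h2
    linear_combination h2

end Form

/-! ### Truncated polynomials in one variable. -/

section OneVariable

variable {τ : Type} {A : Type} [CommRing A] {n m : ℕ}

/-- The coefficient of `T^i` of a truncated polynomial in one variable. -/
def ucoeff (i : ℕ) : TruncPoly Unit A n →ₗ[A] A := tcoeff (Finsupp.single () i)

lemma ucoeff_of_lt {i : ℕ} (hi : n < i) (x : TruncPoly Unit A n) : ucoeff i x = 0 :=
  tcoeff_eq_zero (by simpa using hi) x

lemma ucoeff_eq_zero_of_mem {i : ℕ} (hi : i < m) {x : TruncPoly Unit A n}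
    (hx : x ∈ augIdeal Unit A n ^ m) : ucoeff i x = 0 :=
  tcoeff_eq_zero_of_mem (by simpa using hi) hx

/-- The variable `T`. -/
abbrev tvar : TruncPoly Unit A n := gen ()

lemma ucoeff_smul_tvar_pow {i j : ℕ} (hi : i ≤ n) (a : A) :
    ucoeff i (a • (tvar : TruncPoly Unit A n) ^ j) = if i = j then a else 0 := by
  classical
  rw [tvar, gen, coe_var, ← map_pow, map_smul, ucoeff, tcoeff_mk (by simpa using hi),
    MvPolynomial.coeff_X_pow]
  by_cases h : i = j
  · simp [h]
  · rw [if_neg h, if_neg, smul_zero]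
    intro h2
    exact h (by simpa using DFunLike.congr_fun h2.symm ())

lemma sub_smul_tvar_pow_mem (hm : m ≤ n) {x : TruncPoly Unit A n}
    (hx : x ∈ augIdeal Unit A n ^ m) :
    x - ucoeff m x • tvar ^ m ∈ augIdeal Unit A n ^ (m + 1) := by
  rw [mem_augIdeal_pow_iff (by lia)]
  intro d hd
  obtain ⟨i, rfl⟩ : ∃ i, d = Finsupp.single () i := ⟨d (), by ext; simp⟩
  have hi : i < m + 1 := by simpa using hd
  change ucoeff i _ = 0
  rw [map_sub, ucoeff_smul_tvar_pow (by lia)]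
  split_ifs with h
  · rw [h, sub_self]
  · rw [ucoeff_eq_zero_of_mem (by lia) hx, sub_zero]

lemma sub_sum_mem (x : Aug Unit A n) (k : ℕ) (hk : k ≤ n) :
    (x : TruncPoly Unit A n) - ∑ i ∈ Finset.Icc 1 k, ucoeff i (x : TruncPoly Unit A n) • tvar ^ i ∈
      augIdeal Unit A n ^ (k + 1) := by
  induction k with
  | zero => simp
  | succ k ih =>
    have h := sub_smul_tvar_pow_mem hk (ih (by lia))
    have h0 : ∑ i ∈ Finset.Icc 1 k,
        ucoeff (k + 1) (ucoeff i (x : TruncPoly Unit A n) • (tvar : TruncPoly Unit A n) ^ i) = 0 := by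
      refine Finset.sum_eq_zero fun i hi => ?_
      rw [ucoeff_smul_tvar_pow (by lia), if_neg]
      have := (Finset.mem_Icc.1 hi).2
      lia
    rw [map_sub, map_sum, h0, sub_zero, sub_sub] at h
    rwa [Finset.sum_Icc_succ_top (by lia)]

lemma eq_sum_ucoeff (x : Aug Unit A n) :
    (x : TruncPoly Unit A n) =
      ∑ i ∈ Finset.Icc 1 n, ucoeff i (x : TruncPoly Unit A n) • tvar ^ i :=
  eq_of_sub_mem_pow (sub_sum_mem x n le_rfl)

lemma tvar_pow_mem (i : ℕ) : (tvar : TruncPoly Unit A n) ^ i ∈ augIdeal Unit A n ^ i :=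
  Ideal.pow_mem_pow (var ()).2 i

/-- The monomial `a T^i`, where `i ≥ 1`. -/
def monom (a : A) (i : ℕ) (hi : 1 ≤ i) : Aug Unit A n :=
  ⟨a • tvar ^ i, Submodule.smul_of_tower_mem _ _
    (Ideal.pow_le_self (Nat.one_le_iff_ne_zero.1 hi) (tvar_pow_mem i))⟩

/-- The truncated polynomial `∑_{1 ≤ i ≤ n} c_i T^i`. -/
def ofCoeff (c : ℕ → A) : Aug Unit A n :=
  ⟨∑ i ∈ Finset.Icc 1 n, c i • tvar ^ i, sum_mem fun i hi =>
    (monom (c i) i (Finset.mem_Icc.1 hi).1).2⟩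

lemma ucoeff_ofCoeff (c : ℕ → A) {i : ℕ} (h1 : 1 ≤ i) (hi : i ≤ n) :
    ucoeff i ((ofCoeff c : Aug Unit A n) : TruncPoly Unit A n) = c i := by
  simp only [ofCoeff, map_sum, ucoeff_smul_tvar_pow hi]
  simp [h1, hi]

end OneVariable

/-! ### The defect of additivity of a truncated series -/

section Defect

variable {σ τ υ : Type} {A : Type} [CommRing A] {n m : ℕ}

lemma subst_sub (g : σ → Aug τ A n) (x y : Aug σ A n) :
    subst g (x - y) = subst g x - subst g y := Subtype.ext (map_sub (substAlgHom g) _ _)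

/-- `f(u)`, for a series `f` in one variable. -/
def ev (f : Aug Unit A n) (u : Aug τ A n) : Aug τ A n := subst (fun _ => u) f

lemma coe_ev (f : Aug Unit A n) (u : Aug τ A n) :
    (ev f u : TruncPoly τ A n) = substAlgHom (fun _ => u) (f : TruncPoly Unit A n) := rfl

lemma substAlgHom_tvar_pow (u : Aug τ A n) (i : ℕ) :
    substAlgHom (fun _ : Unit => u) (tvar ^ i) = (u : TruncPoly τ A n) ^ i := by
  rw [map_pow]
  congr 1
  exact congrArg Subtype.val (subst_var (fun _ : Unit => u) ())

@[simp] lemma ev_var (f : Aug Unit A n) : ev f (var ()) = f := subst_self f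

lemma subst_ev (g : τ → Aug υ A n) (f : Aug Unit A n) (u : Aug τ A n) :
    subst g (ev f u) = ev f (subst g u) := subst_subst _ _ _

lemma ev_zero (f : Aug Unit A n) : ev f (0 : Aug τ A n) = 0 := by
  have h : ∀ x : TruncPoly Unit A n, x ∈ augIdeal Unit A n →
      substAlgHom (fun _ : Unit => (0 : Aug τ A n)) x = 0 := by
    intro x hx
    have h1 := sub_sum_mem ⟨x, hx⟩ n le_rfl
    have h2 := eq_of_sub_mem_pow h1
    simp only at h2
    rw [h2, map_sum]
    refine Finset.sum_eq_zero fun i hi => ?_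
    rw [map_smul, substAlgHom_tvar_pow]
    have := (Finset.mem_Icc.1 hi).1
    simp [zero_pow (show i ≠ 0 by lia)]
  exact Subtype.ext (h f f.2)

lemma ev_sub_smul_pow_mem (hm : m ≤ n) {f : Aug Unit A n}
    (hf : (f : TruncPoly Unit A n) ∈ augIdeal Unit A n ^ m) (u : Aug τ A n) :
    (ev f u : TruncPoly τ A n) - ucoeff m (f : TruncPoly Unit A n) • (u : TruncPoly τ A n) ^ m ∈
      augIdeal τ A n ^ (m + 1) := by
  have h := substAlgHom_mem_pow (fun _ => u) (sub_smul_tvar_pow_mem hm hf)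
  rwa [map_sub, map_smul, substAlgHom_tvar_pow] at h

namespace BudLaw

variable (F : BudLaw A n)

/-- `F(u,v)`. -/
def add (u v : Aug τ A n) : Aug τ A n := subst ![u, v] F.law

lemma subst_add (g : τ → Aug υ A n) (u v : Aug τ A n) :
    subst g (F.add u v) = F.add (subst g u) (subst g v) := by
  rw [add, subst_subst, comp_vec2 (subst g), add]

lemma add_assoc (u v w : Aug τ A n) : F.add (F.add u v) w = F.add u (F.add v w) := by
  have h := congrArg (subst ![u, v, w]) F.assoc
  change subst ![u, v, w] (F.add (F.add (var 0) (var 1)) (var 2)) =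
    subst ![u, v, w] (F.add (var 0) (F.add (var 1) (var 2))) at h
  simp only [subst_add, subst_var] at h
  exact h

lemma add_comm (u v : Aug τ A n) : F.add u v = F.add v u := by
  have h := congrArg (subst ![v, u]) F.comm
  change subst ![v, u] (F.add (var 1) (var 0)) = F.add v u at h
  simp only [subst_add, subst_var] at h
  exact h

lemma add_zero (u : Aug τ A n) : F.add u 0 = u := by
  have h := congrArg (subst (fun _ => u)) F.right_id
  change subst (fun _ => u) (F.add (var ()) 0) = _ at h
  rw [subst_add] at h
  simp only [subst_var] at h
  convert h
  exact (ev_zero (0 : Aug Unit A n)).symm ▸ (Subtype.ext (map_zero (substAlgHom (fun _ => u)))).symm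

/-- `F(T,0) = T` and `F(0,T) = T` force both linear coefficients to be `1`. -/
lemma law_sub_mem (hn : 1 ≤ n) :
    (F.law : TruncPoly (Fin 2) A n) - gen 0 - gen 1 ∈ augIdeal (Fin 2) A n ^ 2 := by
  set g : ℕ → A := fun i => tcoeff (fin2 i (1 - i)) (F.law : TruncPoly (Fin 2) A n)
  have h : (F.law : TruncPoly (Fin 2) A n) - form 1 g (gen 0) (gen 1) ∈
      augIdeal (Fin 2) A n ^ 2 := sub_form_mem hn (by simp)
  have hform : ∀ {R : Type} [CommRing R] [Algebra A R] (u v : R),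
      form 1 g u v = g 0 • v + g 1 • u := by
    intro R _ _ u v
    simp [form, Finset.Nat.antidiagonal_succ]
  rw [hform] at h
  have key : ∀ u v : Aug Unit A n, (F.add u v : TruncPoly Unit A n) -
      (g 0 • (v : TruncPoly Unit A n) + g 1 • (u : TruncPoly Unit A n)) ∈
        augIdeal Unit A n ^ 2 := by
    intro u v
    have h2 := substAlgHom_mem_pow ![u, v] h
    rw [map_sub, _root_.map_add, map_smul, map_smul] at h2
    have e0 := congrArg Subtype.val (subst_var ![u, v] 0)
    have e1 := congrArg Subtype.val (subst_var ![u, v] 1)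
    simp only [coe_subst, Matrix.cons_val_zero, Matrix.cons_val_one] at e0 e1
    rw [e0, e1] at h2
    exact h2
  have hT : ucoeff 1 (tvar : TruncPoly Unit A n) = 1 := by
    simpa using ucoeff_smul_tvar_pow (n := n) (j := 1) hn (1 : A)
  have h1 : g 1 = 1 := by
    have := key (var ()) 0
    rw [add_zero] at this
    have := ucoeff_eq_zero_of_mem (i := 1) (by lia) this
    rw [map_sub, _root_.map_add, map_smul, map_smul] at this
    change ucoeff 1 tvar - (g 0 • ucoeff 1 (0 : TruncPoly Unit A n) + g 1 • ucoeff 1 tvar) = 0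
      at this
    rw [hT, map_zero, smul_zero, smul_eq_mul] at this
    linear_combination -this
  have h0 : g 0 = 1 := by
    have := key 0 (var ())
    rw [add_comm, add_zero] at this
    have := ucoeff_eq_zero_of_mem (i := 1) (by lia) this
    rw [map_sub, _root_.map_add, map_smul, map_smul] at this
    change ucoeff 1 tvar - (g 0 • ucoeff 1 tvar + g 1 • ucoeff 1 (0 : TruncPoly Unit A n)) = 0
      at this
    rw [hT, map_zero, smul_zero, smul_eq_mul] at this
    linear_combination -this
  rw [h0, h1, one_smul, one_smul] at h
  convert h using 1
  ring

/-- The terms of `F` beyond `x + y` have order at least two, so perturbations of order `m` affect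
them only in order `m + 1`. To leading order `F` is ordinary addition, which is why the defect can
be formed with ordinary subtraction. -/
lemma add_sub_add_mem (hn : 1 ≤ n) {u u' v v' : Aug τ A n}
    (hu : (u - u' : TruncPoly τ A n) ∈ augIdeal τ A n ^ m)
    (hv : (v - v' : TruncPoly τ A n) ∈ augIdeal τ A n ^ m) :
    (F.add u v : TruncPoly τ A n) - F.add u' v' - ((u - u') + (v - v')) ∈
      augIdeal τ A n ^ (m + 1) := by
  have h := substAlgHom_sub_mem_succ (g := ![u, v]) (g' := ![u', v']) (m := m)
    (by intro i; fin_cases i <;> assumption) (F.law_sub_mem hn)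
  have e0 := congrArg Subtype.val (subst_var ![u, v] 0)
  have e1 := congrArg Subtype.val (subst_var ![u, v] 1)
  have e2 := congrArg Subtype.val (subst_var ![u', v'] 0)
  have e3 := congrArg Subtype.val (subst_var ![u', v'] 1)
  simp only [coe_subst, Matrix.cons_val_zero, Matrix.cons_val_one] at e0 e1 e2 e3
  simp only [map_sub, gen, e0, e1, e2, e3] at h
  convert h using 1
  simp only [add, coe_subst]
  ring

lemma add_sub_mem_sq (hn : 1 ≤ n) (u v : Aug τ A n) :
    (F.add u v : TruncPoly τ A n) - (u + v) ∈ augIdeal τ A n ^ 2 := by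
  have h := F.add_sub_add_mem (m := 1) hn (u := u) (u' := 0) (v := v) (v' := 0)
    (by simp) (by simp)
  rw [add_zero] at h
  simpa using h

/-- `[l]_F(u)`. -/
def mulBy (u : Aug τ A n) : ℕ → Aug τ A n
  | 0 => 0
  | l + 1 => F.add (mulBy u l) u

lemma subst_mulBy (g : τ → Aug υ A n) (u : Aug τ A n) (l : ℕ) :
    subst g (F.mulBy u l) = F.mulBy (subst g u) l := by
  induction l with
  | zero => exact Subtype.ext (map_zero (substAlgHom g))
  | succ l ih => rw [mulBy, mulBy, subst_add, ih]

lemma mulBy_sub_mem_sq (hn : 1 ≤ n) (u : Aug τ A n) (l : ℕ) :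
    (F.mulBy u l : TruncPoly τ A n) - (l : A) • (u : TruncPoly τ A n) ∈ augIdeal τ A n ^ 2 := by
  induction l with
  | zero => simp [mulBy]
  | succ l ih =>
    have h := add_mem ih (F.add_sub_mem_sq hn (F.mulBy u l) u)
    convert h using 1
    rw [mulBy]
    push_cast
    rw [add_smul, one_smul]
    ring

/-- The defect `f(F(x,y)) - F(f(x),f(y))`. -/
def defect (f : Aug Unit A n) : Aug (Fin 2) A n :=
  ev f (F.add (var 0) (var 1)) - F.add (ev f (var 0)) (ev f (var 1))

lemma subst_defect (f : Aug Unit A n) (u v : Aug τ A n) :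
    subst ![u, v] (F.defect f) = ev f (F.add u v) - F.add (ev f u) (ev f v) := by
  rw [defect, subst_sub, subst_ev, subst_add, subst_add, subst_ev, subst_ev]
  simp only [subst_var, Matrix.cons_val_zero, Matrix.cons_val_one]

lemma defect_eq_zero_iff (f : Aug Unit A n) :
    F.defect f = 0 ↔ subst (fun _ => F.law) f =
      subst ![subst (fun _ => var 0) f, subst (fun _ => var 1) f] F.law := by
  have h : F.add (var 0) (var 1) = F.law := by
    rw [add, show (![var 0, var 1] : Fin 2 → Aug (Fin 2) A n) = var by
      funext i; fin_cases i <;> rfl, subst_self]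
  rw [defect, sub_eq_zero, h]
  rfl

lemma ev_add (f : Aug Unit A n) (hf : F.defect f = 0) (u v : Aug τ A n) :
    ev f (F.add u v) = F.add (ev f u) (ev f v) := by
  have h := F.subst_defect f u v
  rw [hf] at h
  exact sub_eq_zero.1 (h.symm.trans (Subtype.ext (map_zero (substAlgHom ![u, v]))))

lemma ev_mulBy (f : Aug Unit A n) (hf : F.defect f = 0) (u : Aug τ A n) (l : ℕ) :
    ev f (F.mulBy u l) = F.mulBy (ev f u) l := by
  induction l with
  | zero => exact ev_zero f
  | succ l ih => rw [mulBy, mulBy, F.ev_add f hf, ih]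

/-- Both terms of the defect have linear part `a_1 (x + y)`. The induction on the order can
therefore start from an arbitrary `f`. -/
lemma defect_mem_sq (hn : 1 ≤ n) (f : Aug Unit A n) :
    (F.defect f : TruncPoly (Fin 2) A n) ∈ augIdeal (Fin 2) A n ^ 2 := by
  have hf : (f : TruncPoly Unit A n) ∈ augIdeal Unit A n ^ 1 := by simp
  have h0 := ev_sub_smul_pow_mem hn hf (F.add (var 0) (var 1) : Aug (Fin 2) A n)
  have h1 := ev_sub_smul_pow_mem hn hf (var 0 : Aug (Fin 2) A n)
  have h2 := ev_sub_smul_pow_mem hn hf (var 1 : Aug (Fin 2) A n)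
  have h3 := F.add_sub_mem_sq hn (ev f (var 0 : Aug (Fin 2) A n)) (ev f (var 1))
  have h4 := Submodule.smul_of_tower_mem (augIdeal (Fin 2) A n ^ 2)
    (ucoeff 1 (f : TruncPoly Unit A n)) (F.add_sub_mem_sq hn (var 0 : Aug (Fin 2) A n) (var 1))
  convert sub_mem (add_mem h0 h4) (add_mem h3 (add_mem h1 h2)) using 1
  simp only [defect, pow_one, AddSubgroupClass.coe_sub, smul_sub, smul_add]
  ring

/-- The coefficients of the leading form of the defect. -/
def defectCoeff (m : ℕ) (f : Aug Unit A n) (i : ℕ) : A :=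
  tcoeff (fin2 i (m - i)) (F.defect f : TruncPoly (Fin 2) A n)

variable {F} {f : Aug Unit A n}

lemma subst_defect_sub_form_mem (hm : m ≤ n)
    (hf : (F.defect f : TruncPoly (Fin 2) A n) ∈ augIdeal (Fin 2) A n ^ m) (u v : Aug τ A n) :
    (ev f (F.add u v) : TruncPoly τ A n) - F.add (ev f u) (ev f v) -
      form m (F.defectCoeff m f) (u : TruncPoly τ A n) (v : TruncPoly τ A n) ∈
        augIdeal τ A n ^ (m + 1) := by
  have h := substAlgHom_mem_pow ![u, v] (sub_form_mem hm hf)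
  rw [map_sub, map_form] at h
  have e0 := congrArg Subtype.val (subst_var ![u, v] 0)
  have e1 := congrArg Subtype.val (subst_var ![u, v] 1)
  have e2 := congrArg Subtype.val (F.subst_defect f u v)
  simp only [coe_subst, Matrix.cons_val_zero, Matrix.cons_val_one,
    AddSubgroupClass.coe_sub] at e0 e1 e2
  rw [gen, gen, e0, e1, e2] at h
  exact h

/-- The leading form of the defect is a symmetric `2`-cocycle. -/
lemma isSymmCocycle_defectCoeff (h1 : 1 ≤ m) (hm : m ≤ n)
    (hf : (F.defect f : TruncPoly (Fin 2) A n) ∈ augIdeal (Fin 2) A n ^ m) :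
    IsSymmCocycle m (F.defectCoeff m f) := by
  have hn : 1 ≤ n := h1.trans hm
  refine isSymmCocycle_of_mem hm _ ?_ ?_
  · have a := subst_defect_sub_form_mem hm hf (var 0 : Aug (Fin 2) A n) (var 1)
    have b := subst_defect_sub_form_mem hm hf (var 1 : Aug (Fin 2) A n) (var 0)
    rw [F.add_comm (var 1), F.add_comm (ev f (var 1))] at b
    convert sub_mem b a using 1
    ring
  · set x : Aug (Fin 3) A n := var 0
    set y : Aug (Fin 3) A n := var 1
    set z : Aug (Fin 3) A n := var 2
    have hxy := subst_defect_sub_form_mem hm hf x y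
    have hyz := subst_defect_sub_form_mem hm hf y z
    have hxy_z := subst_defect_sub_form_mem hm hf (F.add x y) z
    have hx_yz := subst_defect_sub_form_mem hm hf x (F.add y z)
    have mem : ∀ u v : Aug (Fin 3) A n,
        (ev f (F.add u v) - F.add (ev f u) (ev f v) : TruncPoly (Fin 3) A n) ∈
          augIdeal (Fin 3) A n ^ m := by
      intro u v
      have := substAlgHom_mem_pow ![u, v] hf
      rwa [← coe_subst, F.subst_defect] at this
    have l1 := F.add_sub_add_mem hn (mem x y) (v := ev f z) (v' := ev f z) (by simp)
    have l2 := F.add_sub_add_mem hn (u := ev f x) (u' := ev f x) (by simp) (mem y z)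
    -- Inside the leading form `F(x,y)` and `F(y,z)` may be replaced by `x + y` and `y + z`.
    have f1 := form_sub_mem (m := m) (F.add x y).2 (add_mem x.2 y.2) z.2 z.2
      (F.add_sub_mem_sq hn x y) (by simp) (F.defectCoeff m f)
    have f2 := form_sub_mem (m := m) x.2 x.2 (F.add y z).2 (add_mem y.2 z.2) (by simp)
      (F.add_sub_mem_sq hn y z) (F.defectCoeff m f)
    -- `f` of the triple sum is compared with the triple sum of the `f`-values in two ways.
    -- Associativity identifies both ends, and the difference of the two error terms is the cocycle
    -- expression.
    rw [F.add_assoc] at hxy_z l1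
    convert sub_mem (sub_mem (add_mem hx_yz (add_mem l2 hyz)) (add_mem hxy_z (add_mem l1 hxy)))
      (sub_mem f1 f2) using 1
    ring

/-- The defect vanishes at `y = 0` since `f(F(x,0)) = f(x) = F(f(x),0)`. The cocycle identity,
restricted to positive exponents, does not cover this pure power. -/
lemma defectCoeff_self (hm : m ≤ n)
    (hf : (F.defect f : TruncPoly (Fin 2) A n) ∈ augIdeal (Fin 2) A n ^ m) :
    F.defectCoeff m f m = 0 := by
  have h := subst_defect_sub_form_mem hm hf (var () : Aug Unit A n) 0
  rw [F.add_zero, ev_zero, F.add_zero, sub_self, zero_sub] at h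
  have e : form m (F.defectCoeff m f) ((var () : Aug Unit A n) : TruncPoly Unit A n)
      ((0 : Aug Unit A n) : TruncPoly Unit A n) = F.defectCoeff m f m • tvar ^ m := by
    rw [form, Finset.sum_eq_single (m, 0)]
    · simp
    · rintro ⟨a, b⟩ hab hne
      have := Finset.HasAntidiagonal.mem_antidiagonal.1 hab
      have hb : b ≠ 0 := by rintro rfl; exact hne (by simp at this; rw [this])
      simp [zero_pow hb]
    · simp
  have := ucoeff_eq_zero_of_mem (i := m) (by lia) h
  rw [e, map_neg, ucoeff_smul_tvar_pow hm, if_pos rfl] at this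
  exact neg_eq_zero.1 this

lemma defectCoeff_zero (h1 : 1 ≤ m) (hm : m ≤ n)
    (hf : (F.defect f : TruncPoly (Fin 2) A n) ∈ augIdeal (Fin 2) A n ^ m) :
    F.defectCoeff m f 0 = 0 := by
  rw [(isSymmCocycle_defectCoeff h1 hm hf).symm 0 m (by lia), defectCoeff_self hm hf]

lemma defect_mem_succ (h1 : 1 ≤ m) (hm : m ≤ n)
    (hf : (F.defect f : TruncPoly (Fin 2) A n) ∈ augIdeal (Fin 2) A n ^ m)
    (h : ∀ i, 0 < i → i < m → F.defectCoeff m f i = 0) :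
    (F.defect f : TruncPoly (Fin 2) A n) ∈ augIdeal (Fin 2) A n ^ (m + 1) := by
  have h2 := sub_form_mem hm hf
  have h3 : form m (F.defectCoeff m f) (gen 0 : TruncPoly (Fin 2) A n) (gen 1) = 0 := by
    refine Finset.sum_eq_zero ?_
    rintro ⟨a, b⟩ hab
    have := Finset.HasAntidiagonal.mem_antidiagonal.1 hab
    have : F.defectCoeff m f a = 0 := by
      rcases Nat.eq_zero_or_pos a with rfl | ha
      · exact defectCoeff_zero h1 hm hf
      · rcases (show a ≤ m by simp at this; lia).lt_or_eq with h4 | rfl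
        · exact h a ha h4
        · exact defectCoeff_self hm hf
    simp only [this, zero_smul]
  change (F.defect f : TruncPoly (Fin 2) A n) - form m (F.defectCoeff m f) _ _ ∈ _ at h2
  rwa [h3, sub_zero] at h2

/-- The effect on the defect of a perturbation of order `m`. -/
lemma defect_sub_defect_mem (hn : 1 ≤ n) (hm : m ≤ n) {f' : Aug Unit A n}
    (h : ((f' - f : Aug Unit A n) : TruncPoly Unit A n) ∈ augIdeal Unit A n ^ m) :
    (F.defect f' : TruncPoly (Fin 2) A n) - (F.defect f : TruncPoly (Fin 2) A n) -
      ucoeff m ((f' - f : Aug Unit A n) : TruncPoly Unit A n) •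
        ((gen 0 + gen 1) ^ m - gen 0 ^ m - gen 1 ^ m : TruncPoly (Fin 2) A n) ∈ augIdeal (Fin 2) A n ^ (m + 1) := by
  have e : ∀ u : Aug (Fin 2) A n, (ev f' u : TruncPoly (Fin 2) A n) - ev f u =
      ev (f' - f) u := by
    intro u
    rw [ev, ev, ev, subst_sub]
    rfl
  have h0 := ev_sub_smul_pow_mem hm h (F.add (var 0) (var 1) : Aug (Fin 2) A n)
  have h1 := ev_sub_smul_pow_mem hm h (var 0 : Aug (Fin 2) A n)
  have h2 := ev_sub_smul_pow_mem hm h (var 1 : Aug (Fin 2) A n)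
  have h3 := F.add_sub_add_mem (τ := Fin 2) (m := m) hn (u := ev f' (var 0)) (u' := ev f (var 0))
    (v := ev f' (var 1)) (v' := ev f (var 1)) (by rw [e]; exact substAlgHom_mem_pow _ h)
    (by rw [e]; exact substAlgHom_mem_pow _ h)
  have h4 := Submodule.smul_of_tower_mem (augIdeal (Fin 2) A n ^ (m + 1))
    (ucoeff m ((f' - f : Aug Unit A n) : TruncPoly Unit A n))
    (pow_sub_pow_mem (F.add (var 0) (var 1) : Aug (Fin 2) A n).2 (add_mem (var 0).2 (var 1).2)
      (F.add_sub_mem_sq hn (var 0 : Aug (Fin 2) A n) (var 1)) m)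
  rw [← e] at h0 h1 h2
  convert sub_mem (sub_mem (add_mem h0 h4) h3) (add_mem h1 h2) using 1
  have hd : ∀ f : Aug Unit A n, (F.defect f : TruncPoly (Fin 2) A n) =
      (ev f (F.add (var 0) (var 1)) : Aug (Fin 2) A n) -
        (F.add (ev f (var 0)) (ev f (var 1)) : Aug (Fin 2) A n) := fun _ => rfl
  rw [hd, hd]
  simp only [smul_sub]
  ring

lemma tcoeff_add_pow {i : ℕ} (hi : 0 < i) (him : i < m) (hm : m ≤ n) :
    tcoeff (fin2 i (m - i)) ((gen 0 + gen 1) ^ m - gen 0 ^ m - gen 1 ^ m :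
      TruncPoly (Fin 2) A n) = (m.choose i : A) := by
  classical
  have e : ((gen 0 + gen 1) ^ m - gen 0 ^ m - gen 1 ^ m : TruncPoly (Fin 2) A n) =
      Ideal.Quotient.mk _ ((form m (fun i => (m.choose i : A)) (MvPolynomial.X 0)
        (MvPolynomial.X 1)) - MvPolynomial.X 0 ^ m - MvPolynomial.X 1 ^ m) := by
    rw [map_sub, map_sub, mk_form, (Commute.all _ _).add_pow', form]
    simp [Nat.cast_smul_eq_nsmul]
  have h0 := X_pow_mul_X_pow (A := A) m 0
  have h1 := X_pow_mul_X_pow (A := A) 0 m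
  rw [pow_zero, mul_one] at h0
  rw [pow_zero, one_mul] at h1
  have d0 : fin2 m 0 ≠ fin2 i (m - i) := fun h => by
    have := (fin2_eq_iff.1 h).1; simp [fin2] at this; lia
  have d1 : fin2 0 m ≠ fin2 i (m - i) := fun h => by
    have := (fin2_eq_iff.1 h).1; simp [fin2] at this; lia
  rw [e, tcoeff_mk (by simp; lia), MvPolynomial.coeff_sub, MvPolynomial.coeff_sub, coeff_form,
    if_pos (by simp; lia), h0, h1, MvPolynomial.coeff_monomial, MvPolynomial.coeff_monomial,
    if_neg d0, if_neg d1]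
  simp [fin2]

/-- Changing `f` by `a T^m` to leading order adds `a` times the coboundary of `T^m`. This serves
both to correct `f` and to prove uniqueness. -/
lemma defectCoeff_of_sub_mem (hm : m ≤ n) {f' : Aug Unit A n}
    (h : ((f' - f : Aug Unit A n) : TruncPoly Unit A n) ∈ augIdeal Unit A n ^ m) {i : ℕ}
    (hi : 0 < i) (him : i < m) :
    F.defectCoeff m f' i = F.defectCoeff m f i +
      ucoeff m ((f' - f : Aug Unit A n) : TruncPoly Unit A n) * (m.choose i : A) := by
  have h1 := tcoeff_eq_zero_of_mem (d := fin2 i (m - i)) (by simp; lia)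
    (defect_sub_defect_mem (F := F) (by lia) hm h)
  rw [map_sub, map_sub, map_smul, tcoeff_add_pow hi him hm, smul_eq_mul] at h1
  rw [defectCoeff, defectCoeff]
  linear_combination h1

lemma defect_mem_of_sub_mem (hn : 1 ≤ n) (hm : m ≤ n) {f' : Aug Unit A n}
    (h : ((f' - f : Aug Unit A n) : TruncPoly Unit A n) ∈ augIdeal Unit A n ^ m)
    (hf : (F.defect f : TruncPoly (Fin 2) A n) ∈ augIdeal (Fin 2) A n ^ m) :
    (F.defect f' : TruncPoly (Fin 2) A n) ∈ augIdeal (Fin 2) A n ^ m := by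
  have h1 := Ideal.pow_le_pow_right (Nat.le_succ m) (defect_sub_defect_mem (F := F) hn hm h)
  have h2 : ((gen 0 + gen 1) ^ m - gen 0 ^ m - gen 1 ^ m : TruncPoly (Fin 2) A n) ∈
      augIdeal (Fin 2) A n ^ m :=
    sub_mem (sub_mem (Ideal.pow_mem_pow (add_mem (var 0).2 (var 1).2) m)
      (Ideal.pow_mem_pow (var 0).2 m)) (Ideal.pow_mem_pow (var 1).2 m)
  have h3 := Submodule.smul_of_tower_mem (augIdeal (Fin 2) A n ^ m)
    (ucoeff m ((f' - f : Aug Unit A n) : TruncPoly Unit A n)) h2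
  convert add_mem (add_mem h1 h3) hf using 1
  ring

end BudLaw

end Defect

/-! ### Endomorphisms of bud laws with `[p](T) = T^(p^h)` -/

section Classification

/-- The inner sum is `((r+1)^m - r^m - 1) / p` with `m = p^(k+1)`. Summed over `r < p` it telescopes
to `(p^m - p) / p = p^(m-1) - 1`. -/
lemma sum_choose_div_mul_pow (p : ℕ) [Fact p.Prime] (k : ℕ) :
    ∑ r ∈ Finset.range p, ∑ i ∈ Finset.Ioo 0 (p ^ (k + 1)),
      (p ^ (k + 1)).choose i / p * r ^ i + 1 = p ^ (p ^ (k + 1) - 1) := by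
  have hp : p.Prime := Fact.out
  set m := p ^ (k + 1)
  have hm : 0 < m := pow_pos hp.pos _
  have h1 : ∀ r, p * (∑ i ∈ Finset.Ioo 0 m, m.choose i / p * r ^ i) + (r ^ m + 1) =
      (r + 1) ^ m := by
    intro r
    rw [add_pow, Finset.sum_range_succ, Finset.range_eq_Ico,
      Finset.sum_eq_sum_Ico_succ_bot hm, Finset.mul_sum]
    have : ∀ i ∈ Finset.Ioo 0 m, p * (m.choose i / p * r ^ i) =
        r ^ i * 1 ^ (m - i) * (m.choose i) := by
      intro i hi
      have hi := Finset.mem_Ioo.1 hi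
      have d : p ∣ m.choose i := hp.dvd_choose_pow (by lia) (by lia)
      rw [← mul_assoc, Nat.mul_div_cancel' d]
      ring
    rw [Finset.sum_congr rfl this]
    simp
    have : Finset.Ico 1 m = Finset.Ioo 0 m := by ext; simp [Nat.succ_le_iff]
    rw [this]
    ring
  have h2 : ∀ t, p * (∑ r ∈ Finset.range t, ∑ i ∈ Finset.Ioo 0 m, m.choose i / p * r ^ i) + t =
      t ^ m := by
    intro t
    induction t with
    | zero => simp [hm.ne']
    | succ t ih => rw [Finset.sum_range_succ, mul_add, ← h1 t, ← ih]; ring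
  have h3 := h2 p
  refine Nat.eq_of_mul_eq_mul_left hp.pos ?_
  rw [mul_add, mul_one, h3, ← pow_succ', Nat.sub_add_cancel hm]

namespace BudLaw

variable {A : Type} [CommRing A] {n m : ℕ} {F : BudLaw A n} {f : Aug Unit A n}

/-- The obstruction to commuting with `[l]_F`, to leading order. -/
lemma ev_mulBy_sub_mem (h1 : 1 ≤ m) (hm : m ≤ n)
    (hf : (F.defect f : TruncPoly (Fin 2) A n) ∈ augIdeal (Fin 2) A n ^ m) (l : ℕ) :
    (ev f (F.mulBy (var ()) l) : TruncPoly Unit A n) - (F.mulBy f l : TruncPoly Unit A n) -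
      (∑ r ∈ Finset.range l, ∑ i ∈ Finset.Ioo 0 m, F.defectCoeff m f i * (r : A) ^ i) • tvar ^ m ∈
        augIdeal Unit A n ^ (m + 1) := by
  have hn : 1 ≤ n := h1.trans hm
  induction l with
  | zero => simp [mulBy, ev_zero]
  | succ l ih =>
    set S := ∑ r ∈ Finset.range l, ∑ i ∈ Finset.Ioo 0 m, F.defectCoeff m f i * (r : A) ^ i
    -- Passing from `[l]` to `[l+1]` adds the leading form at `([l](T), T)`, that is at `(l T, T)`
    -- to leading order; its end coefficients are zero.
    have e1 : form m (F.defectCoeff m f) ((l : A) • (tvar : TruncPoly Unit A n)) tvar =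
        (∑ i ∈ Finset.Ioo 0 m, F.defectCoeff m f i * (l : A) ^ i) • tvar ^ m := by
      rw [form, Finset.Nat.sum_antidiagonal_eq_sum_range_succ_mk, Finset.sum_range_succ,
        Finset.range_eq_Ico, Finset.sum_eq_sum_Ico_succ_bot h1, defectCoeff_zero h1 hm hf,
        defectCoeff_self hm hf, zero_smul, zero_smul, _root_.add_zero, _root_.zero_add,
        Finset.sum_smul]
      have : Finset.Ico (0 + 1) m = Finset.Ioo 0 m := by ext; simp [Nat.succ_le_iff]
      rw [this]
      refine Finset.sum_congr rfl fun i hi => ?_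
      have hi := Finset.mem_Ioo.1 hi
      simp only
      rw [smul_pow, smul_mul_assoc, ← pow_add, show i + (m - i) = m by lia, smul_smul]
    have h2 := subst_defect_sub_form_mem hm hf (F.mulBy (var ()) l) (var ())
    have h3 := form_sub_mem (m := m) (F.mulBy (var ()) l).2
      (Submodule.smul_of_tower_mem (augIdeal Unit A n) (l : A) (var ()).2) (var ()).2 (var ()).2
      (F.mulBy_sub_mem_sq hn (var ()) l) (by simp) (F.defectCoeff m f)
    rw [e1] at h3
    have h4 : (ev f (F.mulBy (var ()) l) : TruncPoly Unit A n) - F.mulBy f l ∈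
        augIdeal Unit A n ^ m := by
      have := add_mem (Ideal.pow_le_pow_right (Nat.le_succ m) ih)
        (Submodule.smul_of_tower_mem _ S (tvar_pow_mem m))
      convert this using 1
      ring
    have h5 := F.add_sub_add_mem hn h4 (v := f) (v' := f) (by simp)
    rw [ev_var] at h2
    convert add_mem (add_mem (add_mem h2 h3) h5) ih using 1
    rw [Finset.sum_range_succ, add_smul]
    simp only [mulBy]
    ring

variable (p : ℕ) [Fact p.Prime] [Algebra (ZMod p) A]

/-- In degrees other than powers of `p` the obstruction is a coboundary, so one monomial cancels it.
-/
lemma exists_defect_mem_succ (h1 : 1 ≤ m) (hm : m ≤ n)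
    (hf : (F.defect f : TruncPoly (Fin 2) A n) ∈ augIdeal (Fin 2) A n ^ m) {k s : ℕ}
    (hms : m = p ^ k * s) (hs : 2 ≤ s) (hps : ¬ p ∣ s) :
    ∃ a : A, (F.defect (f + monom a m h1) : TruncPoly (Fin 2) A n) ∈
      augIdeal (Fin 2) A n ^ (m + 1) := by
  obtain ⟨c, hc⟩ := (isSymmCocycle_defectCoeff h1 hm hf).eq_mul_choose p hms hs hps
  refine ⟨-c, ?_⟩
  have hsub : f + monom (-c) m h1 - f = monom (-c) m h1 := by abel
  have hmem : ((f + monom (-c) m h1 - f : Aug Unit A n) : TruncPoly Unit A n) ∈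
      augIdeal Unit A n ^ m := by
    rw [hsub]
    exact Submodule.smul_of_tower_mem _ _ (tvar_pow_mem m)
  refine defect_mem_succ h1 hm (defect_mem_of_sub_mem (h1.trans hm) hm hmem hf) ?_
  intro i hi him
  rw [defectCoeff_of_sub_mem hm hmem hi him, hc i hi him, hsub, monom,
    ucoeff_smul_tvar_pow hm, if_pos rfl]
  ring

/-- The leading form is `c` times the divided cocycle, and it contributes `c (p^(m-1) - 1) = -c` to
the coefficient of `T^m` in `f ∘ [p] - [p] ∘ f`. If that coefficient is zero, so is `c`. -/
lemma defect_mem_succ_of_pow {k : ℕ} (hk : k ≠ 0) (hmk : m = p ^ k) (hm : m ≤ n)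
    (hf : (F.defect f : TruncPoly (Fin 2) A n) ∈ augIdeal (Fin 2) A n ^ m)
    (h0 : ucoeff m ((ev f (F.mulBy (var ()) p) : TruncPoly Unit A n) -
      (F.mulBy f p : TruncPoly Unit A n)) = 0) :
    (F.defect f : TruncPoly (Fin 2) A n) ∈ augIdeal (Fin 2) A n ^ (m + 1) := by
  have hp : p.Prime := Fact.out
  obtain ⟨k, rfl⟩ := Nat.exists_eq_succ_of_ne_zero hk
  have h1 : 1 ≤ m := by rw [hmk]; exact pow_pos hp.pos _
  have hcoc := isSymmCocycle_defectCoeff h1 hm hf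
  have key := ucoeff_eq_zero_of_mem (i := m) (by lia) (ev_mulBy_sub_mem h1 hm hf p)
  rw [map_sub, h0, ucoeff_smul_tvar_pow hm, if_pos rfl, zero_sub, neg_eq_zero] at key
  subst hmk
  obtain ⟨c, hc⟩ := hcoc.eq_mul_choose_div p
  have hp0 : (p : A) = 0 := by
    simpa using natCast_eq_of_modEq p A (a := p) (b := 0) (by simp [Nat.ModEq])
  have hN : ∑ r ∈ Finset.range p, ∑ i ∈ Finset.Ioo 0 (p ^ (k + 1)),
      F.defectCoeff (p ^ (k + 1)) f i * (r : A) ^ i =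
      c * ((p : A) ^ (p ^ (k + 1) - 1) - 1) := by
    rw [← Nat.cast_pow, ← sum_choose_div_mul_pow p k]
    push_cast
    rw [add_sub_cancel_right, Finset.mul_sum]
    refine Finset.sum_congr rfl fun r _ => ?_
    rw [Finset.mul_sum]
    refine Finset.sum_congr rfl fun i hi => ?_
    have hi := Finset.mem_Ioo.1 hi
    rw [hc i hi.1 hi.2, mul_assoc]
  have hm2 : p ^ (k + 1) - 1 ≠ 0 := by
    have := Nat.one_lt_pow (Nat.succ_ne_zero k) hp.one_lt
    simp only [Nat.succ_eq_add_one] at this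
    lia
  rw [hN, hp0, zero_pow hm2, zero_sub, mul_neg, mul_one, neg_eq_zero] at key
  refine defect_mem_succ h1 hm hf fun i hi him => ?_
  rw [hc i hi him, key, zero_mul]

lemma sum_pow_prime_pow {R ι : Type} [CommRing R] (hR : (p : R) = 0) (h : ℕ) (s : Finset ι)
    (u : ι → R) : (∑ i ∈ s, u i) ^ p ^ h = ∑ i ∈ s, u i ^ p ^ h := by
  rcases subsingleton_or_nontrivial R with _ | _
  · exact Subsingleton.elim _ _
  · have : CharP R p := (CharP.charP_iff_prime_eq_zero (Fact.out : p.Prime)).2 hR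
    exact sum_pow_char_pow p h s u

/-- `[p](f(T))` is `[p](T) = T^q` evaluated at `f`, that is `f^q`, and the `q`-th power is additive
in characteristic `p`. -/
lemma ev_mulBy_sub_eq_sum {h : ℕ}
    (hF : (F.mulBy (var () : Aug Unit A n) p : TruncPoly Unit A n) = tvar ^ p ^ h) :
    (ev f (F.mulBy (var ()) p) : TruncPoly Unit A n) - (F.mulBy f p : TruncPoly Unit A n) =
      ∑ i ∈ Finset.Icc 1 n, (ucoeff i (f : TruncPoly Unit A n) -
        ucoeff i (f : TruncPoly Unit A n) ^ p ^ h) • tvar ^ (p ^ h * i) := by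
  have hp0 : (p : A) = 0 := by
    simpa using natCast_eq_of_modEq p A (a := p) (b := 0) (by simp [Nat.ModEq])
  have hT : (p : TruncPoly Unit A n) = 0 := by
    simpa using congrArg (algebraMap A (TruncPoly Unit A n)) hp0
  have h1 : (ev f (F.mulBy (var ()) p) : TruncPoly Unit A n) =
      ∑ i ∈ Finset.Icc 1 n, ucoeff i (f : TruncPoly Unit A n) • tvar ^ (p ^ h * i) := by
    rw [coe_ev, eq_sum_ucoeff f, map_sum, ← eq_sum_ucoeff f]
    refine Finset.sum_congr rfl fun i _ => ?_
    rw [map_smul, substAlgHom_tvar_pow, hF, pow_mul]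
  have h2 : (F.mulBy f p : TruncPoly Unit A n) =
      ∑ i ∈ Finset.Icc 1 n, ucoeff i (f : TruncPoly Unit A n) ^ p ^ h • tvar ^ (p ^ h * i) := by
    have e : F.mulBy f p = subst (fun _ => f) (F.mulBy (var ()) p) := by
      rw [subst_mulBy, subst_var]
    rw [e, coe_subst, hF, substAlgHom_tvar_pow]
    conv_lhs => rw [eq_sum_ucoeff f]
    rw [sum_pow_prime_pow p hT]
    refine Finset.sum_congr rfl fun i _ => ?_
    rw [smul_pow, ← pow_mul, mul_comm i]
  rw [h1, h2, ← Finset.sum_sub_distrib]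
  exact Finset.sum_congr rfl fun i _ => (sub_smul _ _ _).symm

/-- An endomorphism commutes with `[p]`; compare the coefficients of `T^(q i)` in `f(T^q) = f(T)^q`.
The bound `q i ≤ n` keeps this degree from being truncated. -/
lemma ucoeff_pow_of_defect_eq_zero {h : ℕ}
    (hF : (F.mulBy (var () : Aug Unit A n) p : TruncPoly Unit A n) = tvar ^ p ^ h)
    (hf : F.defect f = 0) {i : ℕ} (hi : 1 ≤ i) (hin : p ^ h * i ≤ n) :
    ucoeff i (f : TruncPoly Unit A n) ^ p ^ h = ucoeff i (f : TruncPoly Unit A n) := by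
  have hq : 0 < p ^ h := pow_pos (Fact.out : p.Prime).pos _
  have e := ev_mulBy_sub_eq_sum p (f := f) hF
  rw [F.ev_mulBy f hf, ev_var, sub_self] at e
  have e2 := congrArg (ucoeff (p ^ h * i)) e
  rw [map_zero, map_sum, Finset.sum_eq_single i] at e2
  · rw [ucoeff_smul_tvar_pow hin, if_pos rfl] at e2
    exact (sub_eq_zero.1 e2.symm).symm
  · intro j _ hji
    rw [ucoeff_smul_tvar_pow hin, if_neg]
    intro h3
    exact hji (Nat.eq_of_mul_eq_mul_left hq h3).symm
  · intro hn
    exact absurd (Finset.mem_Icc.2 ⟨hi, (Nat.le_mul_of_pos_left i hq).trans hin⟩) hn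

lemma exists_eq_pow_mul (hm : m ≠ 0) (hpow : ∀ k, m ≠ p ^ k) :
    ∃ k s, m = p ^ k * s ∧ 2 ≤ s ∧ ¬ p ∣ s := by
  obtain ⟨k, s, hs, rfl⟩ := Nat.exists_eq_pow_mul_and_not_dvd hm p (Fact.out : p.Prime).ne_one
  refine ⟨k, s, rfl, ?_, hs⟩
  have h0 : s ≠ 0 := by rintro rfl; simp at hm
  have h1 : s ≠ 1 := by rintro rfl; exact hpow k (by simp)
  lia

/-- Endomorphisms with prescribed coefficients at the powers of `p`. -/
theorem exists_defect_eq_zero {h : ℕ}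
    (hF : (F.mulBy (var () : Aug Unit A n) p : TruncPoly Unit A n) = tvar ^ p ^ h)
    (hn : 1 ≤ n) (c : ℕ → A) (hc : ∀ j, p ^ h * p ^ j ≤ n → c j ^ p ^ h = c j) :
    ∃ f : Aug Unit A n, F.defect f = 0 ∧
      ∀ j, p ^ j ≤ n → ucoeff (p ^ j) (f : TruncPoly Unit A n) = c j := by
  have hp : p.Prime := Fact.out
  suffices H : ∀ m, 1 ≤ m → m ≤ n → ∃ f : Aug Unit A n,
      (F.defect f : TruncPoly (Fin 2) A n) ∈ augIdeal (Fin 2) A n ^ (m + 1) ∧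
      ∀ j, p ^ j ≤ n → ucoeff (p ^ j) (f : TruncPoly Unit A n) = c j by
    obtain ⟨f, hf, hfc⟩ := H n hn le_rfl
    refine ⟨f, Subtype.ext (eq_of_sub_mem_pow ?_), hfc⟩
    simpa using hf
  intro m hm
  induction m, hm using Nat.le_induction with
  | base =>
    intro _
    -- Only the values at powers of `p` matter; the other coefficients of this first guess are
    -- arbitrary and get corrected later.
    refine ⟨ofCoeff (fun i => c (Nat.log p i)), F.defect_mem_sq hn _, fun j hj => ?_⟩
    rw [ucoeff_ofCoeff _ (pow_pos hp.pos j) hj, Nat.log_pow hp.one_lt]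
  | succ m hm ih =>
    intro hmn
    obtain ⟨f, hf, hfc⟩ := ih (by lia)
    by_cases hpow : ∃ k, m + 1 = p ^ k
    · obtain ⟨k, hk⟩ := hpow
      refine ⟨f, defect_mem_succ_of_pow p (k := k) ?_ hk hmn hf ?_, hfc⟩
      · rintro rfl
        simp at hk
        lia
      · rw [ev_mulBy_sub_eq_sum p hF, map_sum]
        refine Finset.sum_eq_zero fun i hi => ?_
        rw [ucoeff_smul_tvar_pow hmn]
        split_ifs with h3
        -- If `q i = p^k` then `i` is itself a power of `p`, so `a_i` is one of the prescribed
        -- coefficients and satisfies `a_i^q = a_i`.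
        · obtain ⟨j, -, rfl⟩ := (Nat.dvd_prime_pow hp).1
            (show i ∣ p ^ k by rw [← hk, h3]; exact dvd_mul_left _ _)
          rw [hfc j (Finset.mem_Icc.1 hi).2, hc j (h3 ▸ hmn), sub_self]
        · rfl
    · have hpow : ∀ k, m + 1 ≠ p ^ k := fun k hk => hpow ⟨k, hk⟩
      obtain ⟨k, s, hks, hs, hps⟩ := exists_eq_pow_mul p (Nat.succ_ne_zero m) hpow
      obtain ⟨a, ha⟩ := exists_defect_mem_succ p (by lia) hmn hf hks hs hps
      -- The correction sits in a degree that is not a power of `p`, so the prescribed coefficients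
      -- are untouched.
      refine ⟨_, ha, fun j hj => ?_⟩
      have : ucoeff (p ^ j) ((f + monom a (m + 1) (by lia) : Aug Unit A n) : TruncPoly Unit A n) =
          ucoeff (p ^ j) (f : TruncPoly Unit A n) + ucoeff (p ^ j) (a • tvar ^ (m + 1)) :=
        map_add _ _ _
      rw [this, ucoeff_smul_tvar_pow hj, if_neg (fun h3 => hpow j h3.symm), _root_.add_zero,
        hfc j hj]

/-- An endomorphism is determined by its coefficients at the powers of `p`. -/
theorem eq_of_defect_eq_zero {f' : Aug Unit A n} (hf : F.defect f = 0)
    (hf' : F.defect f' = 0) (hc : ∀ j, p ^ j ≤ n → ucoeff (p ^ j) (f' : TruncPoly Unit A n) =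
      ucoeff (p ^ j) (f : TruncPoly Unit A n)) : f' = f := by
  have hp : p.Prime := Fact.out
  suffices H : ∀ m, 1 ≤ m → m ≤ n + 1 →
      ((f' - f : Aug Unit A n) : TruncPoly Unit A n) ∈ augIdeal Unit A n ^ m from
    Subtype.ext (eq_of_sub_mem_pow (H (n + 1) (by lia) le_rfl))
  intro m hm
  induction m, hm using Nat.le_induction with
  | base => intro _; exact (pow_one (augIdeal Unit A n)).symm ▸ (f' - f).2
  | succ m hm ih =>
    intro hmn
    have hmn : m ≤ n := by lia
    have h1 := ih (by lia)
    have h2 := sub_smul_tvar_pow_mem hmn h1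
    have h0 : ucoeff m ((f' - f : Aug Unit A n) : TruncPoly Unit A n) = 0 := by
      by_cases hpow : ∃ k, m = p ^ k
      · obtain ⟨k, rfl⟩ := hpow
        have : ucoeff (p ^ k) ((f' - f : Aug Unit A n) : TruncPoly Unit A n) =
            ucoeff (p ^ k) (f' : TruncPoly Unit A n) - ucoeff (p ^ k) (f : TruncPoly Unit A n) :=
          map_sub _ _ _
        rw [this, hc k hmn, sub_self]
      · have hpow : ∀ k, m ≠ p ^ k := fun k hk => hpow ⟨k, hk⟩
        obtain ⟨k, s, hks, hs, hps⟩ := exists_eq_pow_mul p (show m ≠ 0 by lia) hpow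
        have hpk : 0 < p ^ k := pow_pos hp.pos _
        -- Both defects vanish, so the coefficient at `x^(p^k) y^(m - p^k)` says that the leading
        -- coefficient of `f' - f` times the unit `m.choose (p^k)` is zero.
        have h3 := defectCoeff_of_sub_mem (F := F) hmn h1 (i := p ^ k) hpk
          (by rw [hks]; nlinarith)
        have h4 : ∀ g : Aug Unit A n, F.defect g = 0 → F.defectCoeff m g (p ^ k) = 0 := by
          intro g hg
          rw [defectCoeff, hg]
          exact map_zero _
        rw [h4 f hf, h4 f' hf', _root_.zero_add] at h3
        have hu : IsUnit ((m.choose (p ^ k) : ℕ) : A) := by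
          rw [hks, natCast_eq_of_modEq p A (choose_pow_mul_modEq p k s)]
          exact isUnit_natCast_of_not_dvd p A hps
        exact hu.mul_left_eq_zero.1 h3.symm
    rwa [h0, zero_smul, sub_zero] at h2

end BudLaw

end Classification

/-! ### Automorphisms -/

section Automorphisms

variable {A B : Type} [CommRing A] [CommRing B] {n : ℕ}

lemma mem_augIdeal_pow_one {σ : Type} (f : Aug σ A n) :
    (f : TruncPoly σ A n) ∈ augIdeal σ A n ^ 1 := by simp

lemma ev_ev (f g k : Aug Unit A n) : ev (ev f g) k = ev f (ev g k) := subst_ev _ _ _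

lemma ucoeff_one_ev (hn : 1 ≤ n) (f g : Aug Unit A n) :
    ucoeff 1 (ev f g : TruncPoly Unit A n) =
      ucoeff 1 (f : TruncPoly Unit A n) * ucoeff 1 (g : TruncPoly Unit A n) := by
  have h := ucoeff_eq_zero_of_mem (i := 1) (by lia)
    (ev_sub_smul_pow_mem hn (f := f) (mem_augIdeal_pow_one f) g)
  rw [map_sub, map_smul, pow_one, smul_eq_mul] at h
  exact sub_eq_zero.1 h

lemma ucoeff_one_var (hn : 1 ≤ n) : ucoeff 1 (tvar : TruncPoly Unit A n) = 1 := by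
  have h := ucoeff_smul_tvar_pow (n := n) (i := 1) (j := 1) hn (1 : A)
  rwa [one_smul, pow_one, if_pos rfl] at h

/-- A truncated series with invertible linear coefficient has a left inverse. -/
lemma exists_ev_eq_var (hn : 1 ≤ n) (f : Aug Unit A n)
    (hf : IsUnit (ucoeff 1 (f : TruncPoly Unit A n))) : ∃ g : Aug Unit A n, ev g f = var () := by
  suffices H : ∀ m, 1 ≤ m → m ≤ n + 1 → ∃ g : Aug Unit A n,
      (ev g f : TruncPoly Unit A n) - tvar ∈ augIdeal Unit A n ^ m by
    obtain ⟨g, hg⟩ := H (n + 1) (by lia) le_rfl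
    exact ⟨g, Subtype.ext (eq_of_sub_mem_pow hg)⟩
  intro m hm
  induction m, hm using Nat.le_induction with
  | base =>
    intro _
    exact ⟨0, mem_augIdeal_pow_one (ev 0 f - var ())⟩
  | succ m hm ih =>
    intro hmn
    have hmn : m ≤ n := by lia
    obtain ⟨g, hg⟩ := ih (by lia)
    obtain ⟨u, hu⟩ := hf
    set b := ucoeff m ((ev g f : TruncPoly Unit A n) - tvar)
    have h1 := sub_smul_tvar_pow_mem hmn hg
    have h2 := sub_smul_tvar_pow_mem hn (mem_augIdeal_pow_one f)
    rw [← hu, pow_one] at h2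
    have h3 := pow_sub_pow_mem f.2 (Submodule.smul_of_tower_mem (augIdeal Unit A n) (u : A)
      (var ()).2) h2 m
    have h4 := Submodule.smul_of_tower_mem (augIdeal Unit A n ^ (m + 1)) (b * (↑u⁻¹ : A) ^ m) h3
    have h5 : (b * (↑u⁻¹ : A) ^ m) • (((u : A) • tvar) ^ m : TruncPoly Unit A n) =
        b • tvar ^ m := by
      rw [smul_pow, smul_smul, mul_assoc, ← mul_pow, Units.inv_mul, one_pow, mul_one]
    -- Since `f = u T + ⋯`, subtracting `b u^(-m) f^m` removes the error `b T^m`.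
    refine ⟨g - monom (b * (↑u⁻¹ : A) ^ m) m hm, ?_⟩
    have h6 : (ev (g - monom (b * (↑u⁻¹ : A) ^ m) m hm) f : TruncPoly Unit A n) =
        (ev g f : TruncPoly Unit A n) - (b * (↑u⁻¹ : A) ^ m) • (f : TruncPoly Unit A n) ^ m := by
      rw [ev, subst_sub, AddSubgroupClass.coe_sub, coe_subst, coe_subst, monom, map_smul,
        substAlgHom_tvar_pow, coe_ev]
    rw [smul_sub, h5] at h4
    rw [h6]
    convert sub_mem h1 h4 using 1
    ring

lemma exists_ev_inverse (hn : 1 ≤ n) (f : Aug Unit A n)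
    (hf : IsUnit (ucoeff 1 (f : TruncPoly Unit A n))) :
    ∃ g : Aug Unit A n, ev g f = var () ∧ ev f g = var () := by
  obtain ⟨g, hg⟩ := exists_ev_eq_var hn f hf
  have h1 := ucoeff_one_ev hn g f
  rw [hg, ucoeff_one_var hn] at h1
  -- The left inverse `g` has a left inverse `e`, and `e = e ∘ g ∘ f = f`, so `g` is two-sided.
  obtain ⟨e, he⟩ := exists_ev_eq_var hn g (IsUnit.of_mul_eq_one _ h1.symm)
  have hef : e = f := by
    have := ev_ev e g f
    rw [he, hg, ev_var] at this
    rw [← this]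
    exact subst_var (fun _ : Unit => f) ()
  exact ⟨g, hg, hef ▸ he⟩

variable {F : BudLaw A n}

lemma defect_series (f : BudHom F F) : F.defect f.series = 0 := (F.defect_eq_zero_iff _).2 f.hom

lemma exists_aut (hn : 1 ≤ n) (f : Aug Unit A n) (hf : F.defect f = 0)
    (hu : IsUnit (ucoeff 1 (f : TruncPoly Unit A n))) :
    ∃ u : BudAut F, u.val.series = f := by
  obtain ⟨g, hgf, hfg⟩ := exists_ev_inverse hn f hu
  have hgf' : ∀ u : Aug (Fin 2) A n, ev g (ev f u) = u := by
    intro u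
    have := congrArg (subst (fun _ => u)) hgf
    rwa [subst_ev, subst_var] at this
  have hfg' : ∀ u : Aug (Fin 2) A n, ev f (ev g u) = u := by
    intro u
    have := congrArg (subst (fun _ => u)) hfg
    rwa [subst_ev, subst_var] at this
  have hg : F.defect g = 0 := by
    rw [BudLaw.defect, sub_eq_zero, ← hgf' (F.add (ev g (var 0)) (ev g (var 1))),
      F.ev_add f hf, hfg', hfg']
  exact ⟨⟨⟨f, (F.defect_eq_zero_iff _).1 hf⟩, ⟨g, (F.defect_eq_zero_iff _).1 hg⟩,
    BudHom.ext hfg, BudHom.ext hgf⟩, rfl⟩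

lemma isUnit_ucoeff_one (hn : 1 ≤ n) (u : BudAut F) :
    IsUnit (ucoeff 1 (u.val.series : TruncPoly Unit A n)) := by
  have h : ev u.val.series u.inv.series = var () := congrArg BudHom.series u.val_inv
  have h1 := ucoeff_one_ev hn u.val.series u.inv.series
  rw [h, ucoeff_one_var hn] at h1
  exact IsUnit.of_mul_eq_one _ h1.symm

lemma ucoeff_mapAug (φ : A →+* B) (f : Aug Unit A n) (i : ℕ) :
    ucoeff i (mapAug φ f : TruncPoly Unit B n) = φ (ucoeff i (f : TruncPoly Unit A n)) := by
  by_cases hi : i ≤ n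
  · obtain ⟨f, hf⟩ := f
    obtain ⟨q, rfl⟩ := Ideal.Quotient.mk_surjective f
    simp only [mapAug, mapRingHom_mk]
    rw [ucoeff, ucoeff, tcoeff_mk (by simpa using hi), tcoeff_mk (by simpa using hi),
      MvPolynomial.coeff_map]
  · rw [ucoeff_of_lt (by lia), ucoeff_of_lt (by lia), map_zero]

/-- The exponents `j` of the powers `p^j` that occur. -/
def expo {r h : ℕ} : Fin (r + 1) ⊕ Fin h → ℕ
  | .inl i => i
  | .inr i => r + 1 + i

/-- The coefficients of an automorphism at the powers of `p`. -/
def autCoeff (p r h : ℕ) (u : BudAut F) (s : Fin (r + 1) ⊕ Fin h) : A :=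
  ucoeff (p ^ expo s) (u.val.series : TruncPoly Unit A n)

/-- The coordinates in which automorphisms are parametrized. -/
def autCoords (p r h : ℕ) (A : Type) [CommRing A] : Set (Fin (r + 1) ⊕ Fin h → A) :=
  {c | c (.inl 0) ^ (p ^ h - 1) = 1 ∧ ∀ i, c (.inl i) ^ p ^ h = c (.inl i)}

variable (p : ℕ) [Fact p.Prime] [Algebra (ZMod p) A] {r h : ℕ}

lemma expo_surj (hr : Nat.log p n = r + h) {j : ℕ} (hj : p ^ j ≤ n) (hn : 1 ≤ n) :
    ∃ s : Fin (r + 1) ⊕ Fin h, expo s = j := by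
  have hj' : j ≤ r + h := hr ▸ (Nat.le_log_iff_pow_le (Fact.out : p.Prime).one_lt (by lia)).2 hj
  by_cases h1 : j < r + 1
  · exact ⟨.inl ⟨j, h1⟩, rfl⟩
  · exact ⟨.inr ⟨j - (r + 1), by lia⟩, by simp [expo]; lia⟩

lemma expo_injective : Function.Injective (expo : Fin (r + 1) ⊕ Fin h → ℕ) := by
  rintro (i | i) (j | j) hij <;> simp only [expo] at hij
  · rw [Fin.ext hij]
  · lia
  · lia
  · rw [show i = j from Fin.ext (by lia)]

lemma pow_expo_le (hr : Nat.log p n = r + h) (hn : 1 ≤ n) (s : Fin (r + 1) ⊕ Fin h) :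
    p ^ expo s ≤ n := by
  refine (Nat.le_log_iff_pow_le (Fact.out : p.Prime).one_lt (by lia)).1 ?_
  rw [hr]
  rcases s with i | i <;> simp only [expo] <;> lia

lemma autCoeff_injective (hr : Nat.log p n = r + h) (hn : 1 ≤ n) :
    Function.Injective (autCoeff (F := F) p r h) := by
  intro u v huv
  refine Units.ext (BudHom.ext ?_)
  refine BudLaw.eq_of_defect_eq_zero p (defect_series _) (defect_series _) fun j hj => ?_
  obtain ⟨s, rfl⟩ := expo_surj p hr hj hn
  exact congrFun huv s

lemma range_autCoeff (hr : Nat.log p n = r + h) (hn : 1 ≤ n) (hh : 1 ≤ h)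
    (hF : (F.mulBy (var () : Aug Unit A n) p : TruncPoly Unit A n) = tvar ^ p ^ h) :
    Set.range (autCoeff (F := F) p r h) = autCoords p r h A := by
  have hp : p.Prime := Fact.out
  have hq : 1 < p ^ h := Nat.one_lt_pow (by lia) hp.one_lt
  -- The constrained exponents are exactly those indexed by `Sum.inl`.
  have hlog : ∀ j, p ^ h * p ^ j ≤ n ↔ j < r + 1 := by
    intro j
    rw [← pow_add, ← Nat.le_log_iff_pow_le hp.one_lt (by lia), hr]
    lia
  ext c
  constructor
  · rintro ⟨u, rfl⟩
    have h2 : ∀ i : Fin (r + 1), autCoeff p r h u (.inl i) ^ p ^ h =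
        autCoeff p r h u (.inl i) := fun i =>
      BudLaw.ucoeff_pow_of_defect_eq_zero p hF (defect_series _) (pow_pos hp.pos _)
        ((hlog i).2 i.2)
    refine ⟨?_, h2⟩
    have h1 : IsUnit (autCoeff p r h u (.inl 0)) := by
      simpa [autCoeff, expo] using isUnit_ucoeff_one hn u
    -- Cancelling the unit `a_1` turns `a_1^q = a_1` into `a_1^(q-1) = 1`.
    refine h1.mul_right_cancel ?_
    rw [← pow_succ, Nat.sub_add_cancel hq.le, one_mul]
    exact h2 0
  · rintro ⟨h1, h2⟩
    set c' : ℕ → A := Function.extend expo c 0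
    have hc' : ∀ s, c' (expo s) = c s := fun s => expo_injective.extend_apply c 0 s
    obtain ⟨f, hf, hfc⟩ := BudLaw.exists_defect_eq_zero p hF hn c' (by
      intro j hj
      have : j = expo (.inl ⟨j, (hlog j).1 hj⟩ : Fin (r + 1) ⊕ Fin h) := rfl
      rw [this, hc', h2])
    have hc0 : IsUnit (c (.inl 0)) := IsUnit.of_pow_eq_one h1 (by lia)
    obtain ⟨u, hu⟩ := exists_aut hn f hf (by
      have := hfc 0 (by simpa using hn)
      rw [pow_zero] at this
      rw [this]
      exact (hc' (.inl 0)).symm ▸ hc0)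
    refine ⟨u, funext fun s => ?_⟩
    rw [autCoeff, hu, hfc _ (pow_expo_le p hr hn s), hc']

end Automorphisms

/-! ### Truncation of formal group laws and base change -/

section Truncation

variable {R A : Type} [CommRing R] [CommRing A] {n : ℕ}

lemma BudLaw.mapAug_mulBy (φ : R →+* A) (F : BudLaw R n) {τ : Type} (u : Aug τ R n) (l : ℕ) :
    mapAug φ (F.mulBy u l) = (F.map φ).mulBy (mapAug φ u) l := by
  induction l with
  | zero => exact mapAug_zero φ
  | succ l ih =>
    rw [mulBy, mulBy, ← ih, add, add, mapAug_subst, comp_vec2 (mapAug φ)]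
    rfl

lemma constantCoeff_mulSeries (F : FormalGroup R) (l : ℕ) :
    MvPowerSeries.constantCoeff (mulSeries F l : MvPowerSeries Unit R) = 0 := by
  induction l with
  | zero => exact map_zero _
  | succ l ih =>
    exact constantCoeff_subst_two _ _ ih (MvPowerSeries.constantCoeff_X ()) _ F.zero_constantCoeff

lemma truncAug_mulSeries (F : FormalGroup R) [F.IsComm] (l : ℕ) :
    truncAug n (mulSeries F l) (constantCoeff_mulSeries F l) =
      (truncLaw F n).mulBy (var ()) l := by
  induction l with
  | zero => exact truncAug_zero _
  | succ l ih =>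
    have hX : (MvPowerSeries.X () : MvPowerSeries Unit R).constantCoeff = 0 := by simp
    have h := truncAug_subst_two (n := n) (mulSeries F l) (MvPowerSeries.X ())
      (constantCoeff_mulSeries F l) hX _ F.zero_constantCoeff (constantCoeff_mulSeries F (l + 1))
    rw [truncAug_X, ih] at h
    exact h

lemma coe_truncAug_X_pow (q : ℕ)
    (h : (MvPowerSeries.X () ^ q : MvPowerSeries Unit R).constantCoeff = 0) :
    (truncAug n (MvPowerSeries.X () ^ q) h : TruncPoly Unit R n) = tvar ^ q := by
  rw [tvar, gen, coe_var, ← map_pow, truncAug, Ideal.Quotient.eq,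
    MvPolynomial.mem_pow_idealOfVars_iff']
  intro x hx
  rw [MvPolynomial.coeff_sub, MvPowerSeries.coeff_truncTotal _ hx,
    ← MvPolynomial.coeff_coe, MvPolynomial.coe_pow, MvPolynomial.coe_X, sub_self]

/-- Truncation and base change commute with substitution, so the hypothesis on `[p]_H` passes to
every bud law occurring in the functor. -/
lemma mulBy_map_truncLaw (F : FormalGroup R) [F.IsComm] {p q : ℕ}
    (hF : mulSeries F p = PowerSeries.X ^ q) (φ : R →+* A) :
    (((truncLaw F n).map φ).mulBy (var () : Aug Unit A n) p : TruncPoly Unit A n) = tvar ^ q := by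
  have h1 : ((truncLaw F n).mulBy (var () : Aug Unit R n) p : TruncPoly Unit R n) = tvar ^ q := by
    have h0 : (MvPowerSeries.X () ^ q : MvPowerSeries Unit R).constantCoeff = 0 := by
      rw [← constantCoeff_mulSeries F p, hF]
      rfl
    rw [← truncAug_mulSeries, truncAug_congr hF _ h0]
    exact coe_truncAug_X_pow q h0
  have h2 := BudLaw.mapAug_mulBy φ (truncLaw F n) (var () : Aug Unit R n) p
  rw [mapAug_var] at h2
  rw [← h2]
  change mapRingHom φ _ = _
  rw [h1, map_pow]
  congr 1
  exact congrArg Subtype.val (mapAug_var (n := n) φ ())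

end Truncation

/-! ### The coordinate ring -/

section CoordinateRing

variable (p : ℕ) [Fact p.Prime] (r h : ℕ)

/-- The relations `c_0^(q-1) = 1` and `c_i^q = c_i`, where `q = p^h`. -/
def relations : Set (MvPolynomial (Fin (r + 1)) (ZMod p)) :=
  insert (MvPolynomial.X 0 ^ (p ^ h - 1) - 1)
    (Set.range fun i => MvPolynomial.X i ^ p ^ h - MvPolynomial.X i)

/-- The coordinate ring of the étale part. -/
abbrev EtaleRing : Type :=
  MvPolynomial (Fin (r + 1)) (ZMod p) ⧸ Ideal.span (relations p r h)

/-- The coordinate ring of the automorphism group scheme. -/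
abbrev CoordRing : Type := MvPolynomial (Fin h) (EtaleRing p r h)

/-- The coordinates `c_i` of the étale part. -/
def etaleCoord (i : Fin (r + 1)) : EtaleRing p r h := Ideal.Quotient.mk _ (MvPolynomial.X i)

/-- The coordinates on the automorphism group scheme. -/
def coord : Fin (r + 1) ⊕ Fin h → CoordRing p r h
  | .inl i => MvPolynomial.C (etaleCoord p r h i)
  | .inr i => MvPolynomial.X i

variable {p r h}

lemma etaleCoord_zero_pow : etaleCoord p r h 0 ^ (p ^ h - 1) = 1 := by
  rw [etaleCoord, ← map_pow, ← map_one (Ideal.Quotient.mk _), Ideal.Quotient.eq]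
  exact Ideal.subset_span (Or.inl rfl)

lemma etaleCoord_pow (i : Fin (r + 1)) : etaleCoord p r h i ^ p ^ h = etaleCoord p r h i := by
  rw [etaleCoord, ← map_pow, Ideal.Quotient.eq]
  exact Ideal.subset_span (Or.inr ⟨i, rfl⟩)

variable {A : Type} [CommRing A]

lemma etaleRing_hom_ext {φ ψ : EtaleRing p r h →+* A}
    (hφ : ∀ i, φ (etaleCoord p r h i) = ψ (etaleCoord p r h i)) : φ = ψ := by
  apply Ideal.Quotient.ringHom_ext
  apply MvPolynomial.ringHom_ext
  · intro a
    exact RingHom.congr_fun (RingHom.ext_zmod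
      ((φ.comp (Ideal.Quotient.mk _)).comp MvPolynomial.C)
      ((ψ.comp (Ideal.Quotient.mk _)).comp MvPolynomial.C)) a
  · exact hφ

lemma coordRing_hom_ext {φ ψ : CoordRing p r h →+* A}
    (hφ : ∀ s, φ (coord p r h s) = ψ (coord p r h s)) : φ = ψ := by
  apply MvPolynomial.ringHom_ext
  · intro a
    exact RingHom.congr_fun (etaleRing_hom_ext (φ := φ.comp MvPolynomial.C)
      (ψ := ψ.comp MvPolynomial.C) fun i => hφ (.inl i)) a
  · exact fun i => hφ (.inr i)

lemma range_coord [Algebra (ZMod p) A] :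
    Set.range (fun (φ : CoordRing p r h →+* A) s => φ (coord p r h s)) = autCoords p r h A := by
  ext c
  constructor
  · rintro ⟨φ, rfl⟩
    refine ⟨?_, fun i => ?_⟩
    · simp only [coord]
      rw [← map_pow, ← map_pow, etaleCoord_zero_pow, map_one, map_one]
    · simp only [coord]
      rw [← map_pow, ← map_pow, etaleCoord_pow]
  · rintro ⟨h1, h2⟩
    set θ : MvPolynomial (Fin (r + 1)) (ZMod p) →+* A :=
      MvPolynomial.eval₂Hom (algebraMap (ZMod p) A) (fun i => c (.inl i))
    have hθ : ∀ a ∈ Ideal.span (relations p r h), θ a = 0 := by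
      intro a ha
      have hle : Ideal.span (relations p r h) ≤ RingHom.ker θ := by
        refine Ideal.span_le.2 ?_
        rintro _ (rfl | ⟨i, rfl⟩)
        · simp [θ, RingHom.mem_ker, h1]
        · simp [θ, RingHom.mem_ker, h2]
      exact hle ha
    refine ⟨MvPolynomial.eval₂Hom (Ideal.Quotient.lift _ θ hθ) (fun i => c (.inr i)),
      funext ?_⟩
    rintro (i | i)
    · simp [coord, etaleCoord, θ]
    · simp [coord]

/-! ### Étaleness, smoothness and dimension. -/

instance : Algebra.FiniteType (ZMod p) (EtaleRing p r h) :=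
  Algebra.FiniteType.of_surjective (Ideal.Quotient.mkₐ (ZMod p) _) Ideal.Quotient.mk_surjective

/-- Two lifts of a coordinate differ by `d` in a square-zero ideal, so `d^q = 0`. Both lifts satisfy
`c^q = c` and the `q`-th power is additive, so `d = d^q = 0`. -/
lemma formallyUnramified_etaleRing (hh : 1 ≤ h) :
    Algebra.FormallyUnramified (ZMod p) (EtaleRing p r h) := by
  have hp : p.Prime := Fact.out
  have hq : 1 < p ^ h := Nat.one_lt_pow (by lia) hp.one_lt
  refine Algebra.FormallyUnramified.iff_comp_injective.2 fun B _ _ I hI f g hfg => ?_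
  refine AlgHom.coe_ringHom_injective (etaleRing_hom_ext fun i => ?_)
  change f (etaleCoord p r h i) = g (etaleCoord p r h i)
  have hmem : f (etaleCoord p r h i) - g (etaleCoord p r h i) ∈ I :=
    Ideal.Quotient.eq.1 (AlgHom.congr_fun hfg (etaleCoord p r h i))
  have h0 : (f (etaleCoord p r h i) - g (etaleCoord p r h i)) ^ p ^ h = 0 := by
    have := Ideal.pow_le_pow_right (show 2 ≤ p ^ h from hq) (Ideal.pow_mem_pow hmem (p ^ h))
    rwa [hI, Ideal.mem_bot] at this
  rcases subsingleton_or_nontrivial B with _ | _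
  · exact Subsingleton.elim _ _
  · have : CharP B p := charP_of_injective_algebraMap (algebraMap (ZMod p) B).injective p
    rw [sub_pow_char_pow, ← map_pow, ← map_pow, etaleCoord_pow] at h0
    exact sub_eq_zero.1 h0

lemma etale_etaleRing (hh : 1 ≤ h) : Algebra.Etale (ZMod p) (EtaleRing p r h) := by
  have := formallyUnramified_etaleRing (p := p) (r := r) hh
  have : Algebra.FormallyEtale (ZMod p) (EtaleRing p r h) :=
    Algebra.FormallyEtale.of_formallyUnramified_of_field _ _
  exact ⟨inferInstance, Algebra.FinitePresentation.of_finiteType.1 inferInstance⟩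

instance : Nontrivial (EtaleRing p r h) := by
  -- The identity automorphism is a rational point: `c_0 = 1` and all other coordinates `0`.
  -- Non-emptiness is needed for the Krull dimension.
  have hmem : (fun s => Sum.elim (fun i => if i = 0 then 1 else 0) 0 s) ∈
      autCoords p r h (ZMod p) := by
    refine ⟨by simp, fun i => ?_⟩
    by_cases hi : i = 0 <;> simp [hi]
  rw [← range_coord] at hmem
  obtain ⟨φ, -⟩ := hmem
  exact (φ.comp MvPolynomial.C).domain_nontrivial

/-- The étale part is finite over a field, hence Artinian of dimension `0`, and each of the `h`
variables adds one. -/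
lemma ringKrullDim_coordRing (hh : 1 ≤ h) : ringKrullDim (CoordRing p r h) = h := by
  have := formallyUnramified_etaleRing (p := p) (r := r) hh
  have : Module.Finite (ZMod p) (EtaleRing p r h) :=
    Algebra.FormallyUnramified.finite_of_free _ _
  have : IsArtinianRing (EtaleRing p r h) := IsArtinianRing.of_finite (ZMod p) _
  have h0 : ringKrullDim (EtaleRing p r h) = 0 :=
    ringKrullDimZero_iff_ringKrullDim_eq_zero.1 inferInstance
  rw [MvPolynomial.ringKrullDim_of_isNoetherianRing, h0, zero_add, Nat.card_fin]

/-- In the presentation by the variables with no relations, the Jacobian matrix is empty, with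
determinant `1`. -/
lemma isStandardSmoothOfRelativeDimension_mvPolynomial (R : Type) [CommRing R] (h : ℕ) :
    Algebra.IsStandardSmoothOfRelativeDimension h R (MvPolynomial (Fin h) R) := by
  let P : Algebra.SubmersivePresentation R (MvPolynomial (Fin h) R) (Fin h) PEmpty.{1} :=
    { toGenerators := Algebra.Generators.mvPolynomial R (Fin h)
      relation := PEmpty.elim
      span_range_relation_eq_ker := by
        rw [Set.range_eq_empty, Ideal.span_empty]
        symm
        rw [Algebra.Generators.ker_eq_ker_aeval_val]
        refine (RingHom.injective_iff_ker_eq_bot _).1 ?_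
        intro a b hab
        simpa [Algebra.Generators.mvPolynomial] using hab
      map := PEmpty.elim
      map_inj := fun a => a.elim
      jacobian_isUnit := by
        rw [Algebra.PreSubmersivePresentation.jacobian_eq_jacobiMatrix_det, Matrix.det_isEmpty,
          map_one]
        exact isUnit_one }
  exact P.isStandardSmoothOfRelativeDimension (by simp [Algebra.Presentation.dimension])

lemma isStandardSmoothOfRelativeDimension_coordRing (hh : 1 ≤ h) :
    Algebra.IsStandardSmoothOfRelativeDimension h (ZMod p) (CoordRing p r h) := by
  have := etale_etaleRing (p := p) (r := r) hh
  have : Algebra.IsStandardSmoothOfRelativeDimension 0 (ZMod p) (EtaleRing p r h) :=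
    Algebra.Etale.iff_isStandardSmoothOfRelativeDimension_zero.1 this
  have := isStandardSmoothOfRelativeDimension_mvPolynomial (EtaleRing p r h) h
  exact Algebra.IsStandardSmoothOfRelativeDimension.trans (n := 0) (m := h) (ZMod p)
    (EtaleRing p r h) (CoordRing p r h)

end CoordinateRing

/-! ### Representability -/

section Representability

variable {p : ℕ} [Fact p.Prime]

/-- `Spec R` as a scheme over `𝔽_p`. -/
def overSpec (p : ℕ) [Fact p.Prime] (R : Type) [CommRing R] [Algebra (ZMod p) R] :
    Over (Spec (CommRingCat.of (ZMod p))) :=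
  Over.mk (Spec.map (CommRingCat.ofHom (algebraMap (ZMod p) R)))

variable {R : Type} [CommRing R] [Algebra (ZMod p) R]

/-- The map `R → Γ(S)` belonging to `S → Spec R`. -/
def toRingHom {S : Over (Spec (CommRingCat.of (ZMod p)))} (f : S ⟶ overSpec p R) :
    R →+* Γ(S.left, ⊤) :=
  ((Scheme.ΓSpecIso (CommRingCat.of R)).inv ≫
    (show S.left ⟶ Spec (CommRingCat.of R) from f.left).appTop).hom

lemma toRingHom_bijective (S : Over (Spec (CommRingCat.of (ZMod p)))) :
    Function.Bijective (toRingHom (S := S) (R := R)) := by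
  constructor
  · intro f g hfg
    apply Over.OverMorphism.ext
    have h := CommRingCat.hom_ext hfg
    rw [cancel_epi] at h
    exact ext_of_isAffine (Y := Spec (CommRingCat.of R)) h
  · intro φ
    have key : (Scheme.ΓSpecIso (CommRingCat.of R)).inv ≫
        (S.left.toSpecΓ ≫ Spec.map (CommRingCat.ofHom φ)).appTop = CommRingCat.ofHom φ := by
      simp
    refine ⟨Over.homMk (S.left.toSpecΓ ≫ Spec.map (CommRingCat.ofHom φ)) ?_, ?_⟩
    -- Compatibility with the structure maps is automatic, since a ring receives at most one
    -- homomorphism from `ZMod p`.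
    · apply ext_of_isAffine
      rw [← cancel_epi (Scheme.ΓSpecIso (CommRingCat.of (ZMod p))).inv]
      exact CommRingCat.hom_ext (RingHom.ext_zmod (n := p) _ _)
    · exact congrArg CommRingCat.Hom.hom key

variable (H : FormalGroup (ZMod p)) [H.IsComm] {n r h : ℕ}

/-- The automorphism functor is represented by the spectrum of the coordinate ring. -/
lemma nonempty_representableBy (hr : Nat.log p n = r + h) (hn : 1 ≤ n) (hh : 1 ≤ h)
    (hH : mulSeries H p = PowerSeries.X ^ (p ^ h)) :
    Nonempty ((autFunctor (truncLaw H n) ⋙ forget GrpCat).RepresentableBy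
      (overSpec p (CoordRing p r h))) := by
  let a (S : Over (Spec (CommRingCat.of (ZMod p)))) (f : S ⟶ overSpec p (CoordRing p r h)) :
      Fin (r + 1) ⊕ Fin h → Γ(S.left, ⊤) := fun s => toRingHom f (coord p r h s)
  let b (S : Over (Spec (CommRingCat.of (ZMod p))))
      (u : BudAut ((truncLaw H n).map (structureMap S))) :
      Fin (r + 1) ⊕ Fin h → Γ(S.left, ⊤) := autCoeff p r h u
  have ha : ∀ S, Function.Injective (a S) := fun S f g hfg =>
    (toRingHom_bijective S).1 (coordRing_hom_ext fun s => congrFun hfg s)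
  have hb : ∀ S, Function.Injective (b S) := fun S =>
    let _ : Algebra (ZMod p) Γ(S.left, ⊤) := (structureMap S).toAlgebra
    autCoeff_injective p hr hn
  have hab : ∀ S, Set.range (a S) = Set.range (b S) := fun S => by
    let _ : Algebra (ZMod p) Γ(S.left, ⊤) := (structureMap S).toAlgebra
    have h1 : Set.range (a S) =
        Set.range (fun (φ : CoordRing p r h →+* Γ(S.left, ⊤)) s => φ (coord p r h s)) := by
      ext c
      constructor
      · rintro ⟨f, rfl⟩
        exact ⟨toRingHom f, rfl⟩
      · rintro ⟨φ, rfl⟩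
        obtain ⟨f, rfl⟩ := (toRingHom_bijective (R := CoordRing p r h) S).2 φ
        exact ⟨f, rfl⟩
    rw [h1, range_coord]
    exact (range_autCoeff p hr hn hh (mulBy_map_truncLaw H hH (structureMap S))).symm
  -- Points and automorphisms both embed into tuples of global sections with the same image. This
  -- gives the bijection without a formula for the automorphism, and naturality need only be checked
  -- on coordinates.
  let e (S : Over (Spec (CommRingCat.of (ZMod p)))) :
      (S ⟶ overSpec p (CoordRing p r h)) ≃ BudAut ((truncLaw H n).map (structureMap S)) :=
    (Equiv.ofInjective _ (ha S)).trans
      ((Equiv.setCongr (hab S)).trans (Equiv.ofInjective _ (hb S)).symm)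
  have he : ∀ S f, b S (e S f) = a S f := fun S f =>
    congrArg Subtype.val ((Equiv.ofInjective _ (hb S)).apply_symm_apply
      (Equiv.setCongr (hab S) (Equiv.ofInjective _ (ha S) f)))
  refine ⟨{ homEquiv := fun {S} => e S, homEquiv_comp := fun {T S} g f => hb T ((he T _).trans ?_) }⟩
  funext s
  have h2 : b T ((autFunctor (truncLaw H n) ⋙ forget GrpCat).map g.op (e S f)) s =
      g.left.appTop.hom (b S (e S f) s) := ucoeff_mapAug _ _ _
  have h3 : g.left.appTop.hom (b S (e S f) s) = g.left.appTop.hom (a S f s) := by rw [he]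
  exact (h2.trans h3).symm

lemma smoothOfRelativeDimension_overSpec (hh : 1 ≤ h) :
    SmoothOfRelativeDimension h (overSpec p (CoordRing p r h)).hom := by
  refine (HasRingHomProperty.Spec_iff (P := @SmoothOfRelativeDimension h)).2 ?_
  refine RingHom.locally_of RingHom.isStandardSmoothOfRelativeDimension_respectsIso _ ?_
  have := isStandardSmoothOfRelativeDimension_coordRing (p := p) (r := r) hh
  exact (RingHom.isStandardSmoothOfRelativeDimension_algebraMap _).2 this

lemma topologicalKrullDim_overSpec (hh : 1 ≤ h) :
    topologicalKrullDim (overSpec p (CoordRing p r h)).left = h :=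
  (PrimeSpectrum.topologicalKrullDim_eq_ringKrullDim (CoordRing p r h)).trans
    (ringKrullDim_coordRing hh)

end Representability

end FormalBud

end

/-! ### The automorphism group scheme. -/

theorem mainTheorem7 (p : ℕ) [Fact p.Prime] (h n : ℕ) (hh : 1 ≤ h) (hn : p ^ (h + 1) ≤ n)
    (H : FormalGroup (ZMod p)) [H.IsComm]
    (hH : FormalBud.mulSeries H p = PowerSeries.X ^ (p ^ h)) :
    ∃ (G : Over (Spec (CommRingCat.of (ZMod p)))) (_ : GrpObj G),
      Nonempty (yonedaGrpObj G ≅ FormalBud.autFunctor (FormalBud.truncLaw H n)) ∧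
      SmoothOfRelativeDimension h G.hom ∧
      topologicalKrullDim G.left = h := by
  have hp : p.Prime := Fact.out
  have hn1 : 1 ≤ n := (Nat.one_le_pow _ _ hp.pos).trans hn
  have hlog : h + 1 ≤ Nat.log p n := (Nat.le_log_iff_pow_le hp.one_lt (by lia)).2 hn
  -- `r` is the largest `j` with `p^h * p^j ≤ n`: the exponents `0, …, r` carry the étale
  -- coordinates and `r+1, …, r+h` the free ones.
  obtain ⟨r, hr⟩ : ∃ r, Nat.log p n = r + h := ⟨Nat.log p n - h, by lia⟩
  obtain ⟨α⟩ := FormalBud.nonempty_representableBy H hr hn1 hh hH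
  exact ⟨FormalBud.overSpec p (FormalBud.CoordRing p r h), GrpObj.ofRepresentableBy _ _ α,
    ⟨yonedaGrpObjIsoOfRepresentableBy _ _ α⟩, FormalBud.smoothOfRelativeDimension_overSpec hh,
    FormalBud.topologicalKrullDim_overSpec hh⟩
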